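/- Let $N\ge 1$, let $(\Omega,\mathfrak F,\mathbb P)$ be a probability space and let $(\theta_t)_{t\in\mathbb R}$ be an ergodic measure-preserving dynamical system on it: $(t,\omega)\mapsto\theta_t\omega$ is jointly measurable, $\theta_0=\mathrm{Id}$, $\theta_{s+t}=\theta_t\circ\theta_s$, each $\theta_t$ preserves $\mathbb P$, and every measurable set invariant under all $\theta_t$ has probability $0$ or $1$. Let $A=(a_{ij})\colon\Omega\to\mathbb R^{N\times N}$ be such that every entry $a_{ij}$ is $\mathbb P$-integrable and, for each $\omega\in\Omega$, $A(\omega)$ is an ML-matrix, i.e. $a_{ij}(\omega)\ge 0$ for $i\neq j$. Then there is a unique real number $\lambda$, the top Lyapunov exponent of the random linear system $x'=A(\theta_t\omega)x$, with the following property: there is an invariant measurable set $\Omega_1\subset\Omega$ with $\mathbb P(\Omega_1)=1$ such that for every $\omega\in\Omega_1$ the system generates a unique solution operator $U_\omega(t)$, $t\in\mathbb R$ (for each $x_0\in\mathbb R^N$, $t\mapsto U_\omega(t)x_0$ is a Carathéodory solution on $\mathbb R$ with value $x_0$ at $t=0$), and $$\lim_{t\to\infty}\frac{\ln\|U_\omega(t)\|}{t}=\lambda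 ,$$ where $\|\cdot\|$ is the operator norm induced by the Euclidean norm. Moreover, $\omega\mapsto\min_{i}\sum_{j}a_{ij}(\omega)$ is integrable and $$\lambda\ \ge\ \int_\Omega\Bigl(\min_{1\le i\le N}\ \sum_{j=1}^N a_{ij}(\omega)\Bigr)\,d\mathbb P(\omega).$$ -/

import Mathlib

open MeasureTheory Filter Topology

/-- An ML-matrix: a real square matrix whose off-diagonal entries are nonnegative. -/
def IsMLMatrix {N : ℕ} (M : Matrix (Fin N) (Fin N) ℝ) : Prop :=
  ∀ i j, i ≠ j → 0 ≤ M i j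

/-- `x` is the Carathéodory solution on the whole real line of `x' = B(t) x`, `x(0) = x₀`:
it is absolutely continuous on every compact interval, it has the initial value `x₀`, and it
satisfies the equation for Lebesgue-almost every `t`. -/
structure IsCaratheodorySolution {N : ℕ} (B : ℝ → Matrix (Fin N) (Fin N) ℝ)
    (x₀ : EuclideanSpace ℝ (Fin N)) (x : ℝ → EuclideanSpace ℝ (Fin N)) : Prop where
  absolutelyContinuous : ∀ a b : ℝ, AbsolutelyContinuousOnInterval x a b
  initial : x 0 = x₀
  equation : ∀ᵐ t : ℝ, HasDerivAt x (Matrix.toEuclideanCLM (𝕜 := ℝ) (B t) (x t)) t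

/-- `U` is a solution operator of `x' = B(t) x`: for every `x₀`, the function `t ↦ U(t) x₀` is a
Carathéodory solution with the initial value `x₀`. -/
def IsSolutionOperator {N : ℕ} (B : ℝ → Matrix (Fin N) (Fin N) ℝ)
    (U : ℝ → EuclideanSpace ℝ (Fin N) →L[ℝ] EuclideanSpace ℝ (Fin N)) : Prop :=
  ∀ x₀, IsCaratheodorySolution B x₀ (fun t => U t x₀)

/-- The solution operator of `x' = B(t) x` (an arbitrary value if there is none). -/
noncomputable def solutionOperator {N : ℕ} (B : ℝ → Matrix (Fin N) (Fin N) ℝ) :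
    ℝ → EuclideanSpace ℝ (Fin N) →L[ℝ] EuclideanSpace ℝ (Fin N) :=
  Classical.epsilon (IsSolutionOperator B)

/-- A measure-preserving dynamical system `(θ_t)`, `t ∈ ℝ`, on a measure space. -/
structure IsMeasurePreservingFlow {Ω : Type*} [MeasurableSpace Ω] (μ : Measure Ω)
    (θ : ℝ → Ω → Ω) : Prop where
  measurable : Measurable (fun p : ℝ × Ω => θ p.1 p.2)
  map_zero : ∀ ω, θ 0 ω = ω
  map_add : ∀ s t ω, θ (s + t) ω = θ t (θ s ω)
  measurePreserving : ∀ t, MeasurePreserving (θ t) μ μ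

/-- A set is invariant under `(θ_t)` if each `θ_t` leaves it invariant. -/
def IsFlowInvariant {Ω : Type*} (θ : ℝ → Ω → Ω) (F : Set Ω) : Prop :=
  ∀ t, θ t ⁻¹' F = F

/-- An ergodic measure-preserving dynamical system: every measurable invariant set has
probability zero or one. -/
structure IsErgodicFlow {Ω : Type*} [MeasurableSpace Ω] (μ : Measure Ω)
    (θ : ℝ → Ω → Ω) : Prop extends IsMeasurePreservingFlow μ θ where
  ergodic : ∀ F : Set Ω, MeasurableSet F → IsFlowInvariant θ F → μ F = 0 ∨ μ F = 1

/-- The linear random dynamical system `U_ω(t)` generated by `x' = A(θ_t ω) x`. -/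
noncomputable def linearRDS {Ω : Type*} {N : ℕ} (θ : ℝ → Ω → Ω)
    (A : Ω → Matrix (Fin N) (Fin N) ℝ) (ω : Ω) :
    ℝ → EuclideanSpace ℝ (Fin N) →L[ℝ] EuclideanSpace ℝ (Fin N) :=
  solutionOperator (fun t => A (θ t ω))

/-- `lam` is the top Lyapunov exponent of `x' = A(θ_t ω) x`: on an invariant set of full measure
the equation generates a unique solution operator `U_ω(t)`, and `ln ‖U_ω(t)‖ / t` tends to `lam`
as `t → ∞`. The norm is the operator norm induced by the Euclidean norm. -/
def IsTopLyapunovExponent {Ω : Type*} [MeasurableSpace Ω] {N : ℕ} (μ : Measure Ω)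
    (θ : ℝ → Ω → Ω) (A : Ω → Matrix (Fin N) (Fin N) ℝ) (lam : ℝ) : Prop :=
  ∃ Ω₁ : Set Ω, MeasurableSet Ω₁ ∧ IsFlowInvariant θ Ω₁ ∧ μ Ω₁ = 1 ∧
    ∀ ω ∈ Ω₁, (∃! U, IsSolutionOperator (fun t => A (θ t ω)) U) ∧
      Tendsto (fun t : ℝ => Real.log ‖linearRDS θ A ω t‖ / t) atTop (𝓝 lam)

/-! Write B(ω) for the operator of A(ω). After a change of A on a null set, t ↦ B(θ_t ω) is locally
integrable along every orbit. By Fubini, for almost every ω the change affects only a null set of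
times, which a Carathéodory equation does not see. The Picard series then gives U_ω(t), and
Gronwall's lemma `eq_zero_of_norm_le_integral` its uniqueness.

The cocycle identity `picardSeries_add` makes ln ‖U_ω(t)‖ a subadditive process whose increments are
bounded by integrals of ‖B(θ_r ω)‖ (`isControlledSubadditive_log_norm`). Existence of λ is then a
case of Kingman's theorem, `IsControlledSubadditive.exists_ae_tendsto`, with λ the infimum over n ≥
1 of the means of ln ‖U(n)‖ / n. Both halves rest on one maximal inequality,
`le_of_subadditive_of_ae_exists_le`, proved by cutting orbits into stopping-time blocks: applied to
the process it bounds the lower limit from below, and applied to negative Birkhoff sums of a single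
f_m it bounds the upper limit from above. Only the flow is ergodic, not its time-m maps. So the
zero-one law is used for flow-invariant sets, and the maximal inequality, which needs no ergodicity,
for the time-m maps.

For the lower bound, adding a multiple c(t) of the identity makes the matrix nonnegative and
multiplies solutions by exp ∫ c. Started at the all-ones vector, each Picard iterate then dominates,
coordinate by coordinate, that of the scalar equation whose coefficient is the minimal row sum
(`picardTerm_le_apply_one`). Hence ‖U_ω(t)‖ is at least the exponential of the integrated minimal
row sum for t ≥ 0. Logarithms and expectations bound every mean defining λ. -/

theorem AbsolutelyContinuousOnInterval.of_dist_le {X Y : Type*} [PseudoMetricSpace X]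
    [PseudoMetricSpace Y] {f : ℝ → X} {g : ℝ → Y} {a b : ℝ}
    (hg : AbsolutelyContinuousOnInterval g a b)
    (h : ∀ x y, dist (f x) (f y) ≤ dist (g x) (g y)) :
    AbsolutelyContinuousOnInterval f a b :=
  squeeze_zero (fun _ => Finset.sum_nonneg fun _ _ => dist_nonneg)
    (fun _ => Finset.sum_le_sum fun _ _ => h _ _) hg

theorem MeasureTheory.LocallyIntegrable.intervalIntegrable_real {F : Type*}
    [NormedAddCommGroup F] {f : ℝ → F} (hf : LocallyIntegrable f volume) (a b : ℝ) :
    IntervalIntegrable f volume a b :=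
  (hf.integrableOn_isCompact isCompact_uIcc).intervalIntegrable

theorem MeasureTheory.LocallyIntegrable.norm_real {F : Type*} [NormedAddCommGroup F]
    {f : ℝ → F} (hf : LocallyIntegrable f volume) : LocallyIntegrable (fun t => ‖f t‖) volume :=
  fun t => (hf t).norm

/-! ### Primitives, absolute continuity and Gronwall's lemma -/

section Primitive

variable {F : Type*} [NormedAddCommGroup F] [NormedSpace ℝ F]

theorem MeasureTheory.LocallyIntegrable.absolutelyContinuous_primitive {f : ℝ → F}
    (hf : LocallyIntegrable f volume) (a b : ℝ) :
    AbsolutelyContinuousOnInterval (fun t => ∫ s in (0 : ℝ)..t, f s) a b := by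
  have hi := hf.norm_real.intervalIntegrable_real
  have h1 : AbsolutelyContinuousOnInterval (fun t => ∫ s in a..t, ‖f s‖) a b :=
    (hi a b).absolutelyContinuousOnInterval_intervalIntegral (by simp)
  refine h1.of_dist_le fun x y => ?_
  rw [dist_eq_norm, Real.dist_eq,
    intervalIntegral.integral_interval_sub_left (hf.intervalIntegrable_real _ _)
      (hf.intervalIntegrable_real _ _),
    intervalIntegral.integral_interval_sub_left (hi _ _) (hi _ _)]
  exact intervalIntegral.norm_integral_le_abs_integral_norm

theorem MeasureTheory.LocallyIntegrable.continuous_primitive_real {f : ℝ → F}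
    (hf : LocallyIntegrable f volume) : Continuous (fun t => ∫ s in (0 : ℝ)..t, f s) :=
  intervalIntegral.continuous_primitive hf.intervalIntegrable_real 0

/-- The difference of f and the primitive of f' is absolutely continuous with derivative zero almost
everywhere, hence constant. -/
theorem integral_eq_sub_of_absolutelyContinuous [CompleteSpace F] {f f' : ℝ → F}
    (hf : ∀ a b, AbsolutelyContinuousOnInterval f a b) (hf' : LocallyIntegrable f' volume)
    (h : ∀ᵐ t, HasDerivAt f (f' t) t) (t : ℝ) : ∫ s in (0 : ℝ)..t, f' s = f t - f 0 := by
  have hac : AbsolutelyContinuousOnInterval (fun x => f x - ∫ s in (0 : ℝ)..x, f' s) 0 t :=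
    (hf 0 t).fun_sub (hf'.absolutelyContinuous_primitive 0 t)
  have hd : ∀ᵐ x, x ∈ Set.uIcc 0 t →
      HasDerivAt (fun x => f x - ∫ s in (0 : ℝ)..x, f' s) 0 x := by
    filter_upwards [h, _root_.LocallyIntegrable.ae_hasDerivAt_integral hf'] with x hx hx' _
    simpa using hx.fun_sub (hx' 0)
  obtain ⟨C, hC⟩ := hac.const_of_ae_hasDerivAt_zero hd
  have h0 := hC 0 (by simp)
  have h1 := hC t (by simp)
  simp only [intervalIntegral.integral_same, sub_zero] at h0
  rw [h0, ← h1]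
  abel

theorem MeasureTheory.LocallyIntegrable.mul_continuous_real {R : Type*} [NormedRing R]
    {b u : ℝ → R} (hb : LocallyIntegrable b volume) (hu : Continuous u) :
    LocallyIntegrable (fun s => b s * u s) volume := by
  rw [locallyIntegrable_iff] at hb ⊢
  intro K hK
  exact (hb K hK).mul_continuousOn hu.continuousOn hK

theorem absolutelyContinuous_pow {f : ℝ → ℝ} {a b : ℝ}
    (hf : AbsolutelyContinuousOnInterval f a b) (n : ℕ) :
    AbsolutelyContinuousOnInterval (fun t => f t ^ n) a b := by
  induction n with
  | zero =>
    simp only [pow_zero]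
    exact ((LipschitzWith.const (1 : ℝ)).lipschitzOnWith).absolutelyContinuousOnInterval
  | succ n ih => simpa only [pow_succ] using ih.fun_mul hf

theorem integral_mul_primitive_pow {b : ℝ → ℝ} (hb : LocallyIntegrable b volume) (n : ℕ)
    (t : ℝ) :
    ∫ s in (0 : ℝ)..t, b s * (∫ r in (0 : ℝ)..s, b r) ^ n
      = (∫ r in (0 : ℝ)..t, b r) ^ (n + 1) / (n + 1) := by
  have hc := hb.continuous_primitive_real
  have h := integral_eq_sub_of_absolutelyContinuous
    (f := fun t => (n + 1 : ℝ)⁻¹ * (∫ r in (0 : ℝ)..t, b r) ^ (n + 1))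
    (f' := fun s => b s * (∫ r in (0 : ℝ)..s, b r) ^ n)
    (fun a c => (absolutelyContinuous_pow (hb.absolutelyContinuous_primitive a c)
      (n + 1)).const_mul _) (hb.mul_continuous_real (hc.pow n)) ?_ t
  · rw [h]
    simp
    field_simp
  · filter_upwards [_root_.LocallyIntegrable.ae_hasDerivAt_integral hb] with x hx
    refine (((hx 0).fun_pow (n + 1)).const_mul (n + 1 : ℝ)⁻¹).congr_deriv ?_
    have : (n : ℝ) + 1 ≠ 0 := by positivity
    push_cast
    field_simp

theorem abs_integral_mul_abs_primitive_pow {b : ℝ → ℝ} (hb : LocallyIntegrable b volume)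
    (hb0 : ∀ s, 0 ≤ b s) (n : ℕ) (t : ℝ) :
    |∫ s in (0 : ℝ)..t, b s * (|∫ r in (0 : ℝ)..s, b r| ^ n / n.factorial)|
      = |∫ r in (0 : ℝ)..t, b r| ^ (n + 1) / (n + 1).factorial := by
  -- The primitive of a nonnegative function keeps one sign between 0 and t; e is that sign, and it
  -- lets the absolute values be pulled out.
  have key : ∃ e : ℝ, |e| = 1 ∧ ∀ s ∈ Set.uIcc 0 t,
      |∫ r in (0 : ℝ)..s, b r| = e * ∫ r in (0 : ℝ)..s, b r := by
    rcases le_total 0 t with ht | ht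
    · refine ⟨1, by simp, fun s hs => ?_⟩
      rw [Set.uIcc_of_le ht] at hs
      rw [one_mul, abs_of_nonneg (intervalIntegral.integral_nonneg hs.1 fun _ _ => hb0 _)]
    · refine ⟨-1, by simp, fun s hs => ?_⟩
      rw [Set.uIcc_of_ge ht] at hs
      rw [intervalIntegral.integral_symm, abs_neg,
        abs_of_nonneg (intervalIntegral.integral_nonneg hs.2 fun _ _ => hb0 _)]
      ring
  obtain ⟨e, he, hs⟩ := key
  have h1 : ∫ s in (0 : ℝ)..t, b s * (|∫ r in (0 : ℝ)..s, b r| ^ n / n.factorial)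
      = ∫ s in (0 : ℝ)..t, (e ^ n / n.factorial) * (b s * (∫ r in (0 : ℝ)..s, b r) ^ n) := by
    refine intervalIntegral.integral_congr fun s hs' => ?_
    simp only [hs s hs', mul_pow]
    ring
  rw [h1, intervalIntegral.integral_const_mul, integral_mul_primitive_pow hb, abs_mul, abs_div,
    abs_div, abs_pow, abs_pow, he, Nat.factorial_succ, one_pow, Nat.abs_cast]
  rw [show |(n : ℝ) + 1| = n + 1 from abs_of_nonneg (by positivity)]
  push_cast
  rw [div_mul_div_comm, one_mul, mul_comm (n.factorial : ℝ)]

/-- The common induction step of Gronwall's lemma and of the bound on Picard iterates: each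
integration against b raises the power and the factorial by one. -/
theorem norm_integral_le_primitive_pow {b : ℝ → ℝ} (hb : LocallyIntegrable b volume)
    (hb0 : ∀ s, 0 ≤ b s) (n : ℕ) (t C : ℝ) (hC : 0 ≤ C) {f : ℝ → F}
    (hf : ∀ s ∈ Set.uIoc 0 t,
      ‖f s‖ ≤ b s * (C * (|∫ r in (0 : ℝ)..s, b r| ^ n / n.factorial))) :
    ‖∫ s in (0 : ℝ)..t, f s‖ ≤ C * (|∫ r in (0 : ℝ)..t, b r| ^ (n + 1) / (n + 1).factorial) := by
  have h1 := intervalIntegral.norm_integral_le_abs_of_norm_le (μ := volume) (a := 0) (b := t)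
    (f := f)
    (g := fun s => C * (b s * (|∫ r in (0 : ℝ)..s, b r| ^ n / n.factorial)))
    ((ae_restrict_iff' measurableSet_uIoc).2 (Eventually.of_forall fun s hs =>
      (hf s hs).trans_eq (by ring)))
    (((hb.mul_continuous_real
      ((hb.continuous_primitive_real.abs.pow n).div_const _)).intervalIntegrable_real 0 t).const_mul
        C)
  rw [intervalIntegral.integral_const_mul, abs_mul,
    abs_integral_mul_abs_primitive_pow hb hb0, abs_of_nonneg hC] at h1
  exact h1

/-- **Gronwall's lemma** for a locally integrable coefficient, with zero initial value. -/
theorem eq_zero_of_norm_le_integral {b : ℝ → ℝ} (hb : LocallyIntegrable b volume)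
    (hb0 : ∀ s, 0 ≤ b s) {x f : ℝ → F} (hx : Continuous x)
    (hf : ∀ s, ‖f s‖ ≤ b s * ‖x s‖) (hxf : ∀ t, x t = ∫ s in (0 : ℝ)..t, f s) (t : ℝ) :
    x t = 0 := by
  obtain ⟨C, hC⟩ := (isCompact_uIcc (a := (0 : ℝ)) (b := t)).exists_bound_of_continuousOn
    hx.continuousOn
  have hC0 : 0 ≤ C := (norm_nonneg _).trans (hC 0 (by simp))
  have key : ∀ n : ℕ, ∀ s ∈ Set.uIcc 0 t,
      ‖x s‖ ≤ C * (|∫ r in (0 : ℝ)..s, b r| ^ n / n.factorial) := by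
    intro n
    induction n with
    | zero => intro s hs; simpa using hC s hs
    | succ n ih =>
      intro s hs
      rw [hxf s]
      refine norm_integral_le_primitive_pow hb hb0 n s C hC0 fun r hr => ?_
      refine (hf r).trans (mul_le_mul_of_nonneg_left (ih r ?_) (hb0 r))
      exact Set.uIcc_subset_uIcc_left hs (Set.uIoc_subset_uIcc hr)
  have hlim := (FloorSemiring.tendsto_pow_div_factorial_atTop
    (|∫ r in (0 : ℝ)..t, b r|)).const_mul C
  rw [mul_zero] at hlim
  exact norm_le_zero_iff.1 (ge_of_tendsto' hlim fun n => key n t (by simp))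

end Primitive

/-! ### The Picard series: convergence and integral equation -/

section Picard

variable {R : Type*} [NormedRing R] [NormedAlgebra ℝ R]

/-- The Picard iterates of the equation `X' = B(t) X`, `X(0) = 1`. -/
noncomputable def picardTerm (B : ℝ → R) : ℕ → ℝ → R
  | 0 => fun _ => 1
  | n + 1 => fun t => ∫ s in (0 : ℝ)..t, B s * picardTerm B n s

/-- The sum of the Picard iterates. -/
noncomputable def picardSeries (B : ℝ → R) (t : ℝ) : R := ∑' n, picardTerm B n t

variable {B : ℝ → R}

theorem continuous_picardTerm (hB : LocallyIntegrable B volume) (n : ℕ) :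
    Continuous (picardTerm B n) := by
  induction n with
  | zero => exact continuous_const
  | succ n ih => exact (hB.mul_continuous_real ih).continuous_primitive_real

variable [NormOneClass R]

theorem norm_picardTerm_le (hB : LocallyIntegrable B volume) (n : ℕ) (t : ℝ) :
    ‖picardTerm B n t‖ ≤ |∫ s in (0 : ℝ)..t, ‖B s‖| ^ n / n.factorial := by
  induction n generalizing t with
  | zero => simp [picardTerm]
  | succ n ih =>
    have := norm_integral_le_primitive_pow (F := R) hB.norm_real (fun s => norm_nonneg _) n t 1
      zero_le_one (f := fun s => B s * picardTerm B n s) fun s _ => by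
        rw [one_mul]
        exact (norm_mul_le _ _).trans (mul_le_mul_of_nonneg_left (ih s) (norm_nonneg _))
    simpa [picardTerm] using this

theorem abs_integral_norm_mono {F : Type*} [NormedAddCommGroup F] {f : ℝ → F}
    (hf : LocallyIntegrable f volume) {s t : ℝ} (hs : s ∈ Set.uIcc 0 t) :
    |∫ r in (0 : ℝ)..s, ‖f r‖| ≤ |∫ r in (0 : ℝ)..t, ‖f r‖| :=
  intervalIntegral.abs_integral_mono_interval
    (Set.uIoc_subset_uIoc_of_uIcc_subset_uIcc (Set.uIcc_subset_uIcc_left hs))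
    (Eventually.of_forall fun _ => norm_nonneg _) (hf.norm_real.intervalIntegrable_real _ _)

theorem norm_picardTerm_le_of_mem (hB : LocallyIntegrable B volume) (n : ℕ) {s t : ℝ}
    (hs : s ∈ Set.uIcc 0 t) :
    ‖picardTerm B n s‖ ≤ |∫ s in (0 : ℝ)..t, ‖B s‖| ^ n / n.factorial :=
  (norm_picardTerm_le hB n s).trans (div_le_div_of_nonneg_right
    (pow_le_pow_left₀ (abs_nonneg _) (abs_integral_norm_mono hB hs) n) (Nat.cast_nonneg _))

theorem norm_picardSeries_le (hB : LocallyIntegrable B volume) (t : ℝ) :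
    ‖picardSeries B t‖ ≤ Real.exp |∫ s in (0 : ℝ)..t, ‖B s‖| := by
  refine tsum_of_norm_bounded ?_ (norm_picardTerm_le hB · t)
  rw [Real.exp_eq_exp_ℝ]
  exact NormedSpace.expSeries_div_hasSum_exp _

variable [CompleteSpace R]

theorem hasSum_picardTerm (hB : LocallyIntegrable B volume) (t : ℝ) :
    HasSum (fun n => picardTerm B n t) (picardSeries B t) :=
  (Summable.of_norm_bounded (Real.summable_pow_div_factorial _)
    (norm_picardTerm_le hB · t)).hasSum

theorem continuous_picardSeries (hB : LocallyIntegrable B volume) :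
    Continuous (picardSeries B) := by
  rw [continuous_iff_continuousAt]
  intro t
  -- A neighbourhood of t symmetric about 0; the sum of the two one-sided integrals bounds the
  -- primitive for both signs of s.
  obtain ⟨M, hM⟩ : ∃ M : ℝ, ∀ (n : ℕ), ∀ s ∈ Set.Icc (-(|t| + 1)) (|t| + 1),
      ‖picardTerm B n s‖ ≤ M ^ n / n.factorial := by
    refine ⟨|∫ s in (0 : ℝ)..(-(|t| + 1)), ‖B s‖| + |∫ s in (0 : ℝ)..(|t| + 1), ‖B s‖|,
      fun n s hs => ?_⟩
    rcases le_total 0 s with h0 | h0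
    · refine (norm_picardTerm_le_of_mem hB n (t := |t| + 1) ?_).trans ?_
      · rw [Set.uIcc_of_le (by positivity)]; exact ⟨h0, hs.2⟩
      · exact div_le_div_of_nonneg_right (pow_le_pow_left₀ (abs_nonneg _)
          (le_add_of_nonneg_left (abs_nonneg _)) n) (Nat.cast_nonneg _)
    · refine (norm_picardTerm_le_of_mem hB n (t := -(|t| + 1)) ?_).trans ?_
      · rw [Set.uIcc_of_ge (by linarith [abs_nonneg t])]; exact ⟨hs.1, h0⟩
      · exact div_le_div_of_nonneg_right (pow_le_pow_left₀ (abs_nonneg _)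
          (le_add_of_nonneg_right (abs_nonneg _)) n) (Nat.cast_nonneg _)
  have h : ContinuousOn (picardSeries B) (Set.Icc (-(|t| + 1)) (|t| + 1)) :=
    continuousOn_tsum (fun n => (continuous_picardTerm hB n).continuousOn)
      (Real.summable_pow_div_factorial M) hM
  exact h.continuousAt (Icc_mem_nhds (by linarith [neg_abs_le t]) (by linarith [le_abs_self t]))

theorem picardSeries_eq (hB : LocallyIntegrable B volume) (t : ℝ) :
    picardSeries B t = 1 + ∫ s in (0 : ℝ)..t, B s * picardSeries B s := by
  have h1 := intervalIntegral.hasSum_integral_of_dominated_convergence (μ := volume)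
    (a := 0) (b := t)
    (F := fun n s => B s * picardTerm B n s) (f := fun s => B s * picardSeries B s)
    (fun n s => ‖B s‖ * (|∫ s in (0 : ℝ)..t, ‖B s‖| ^ n / n.factorial))
    (fun n => ((hB.mul_continuous_real (continuous_picardTerm hB n)).intervalIntegrable_real
      0 t).aestronglyMeasurable_restrict_uIoc)
    (fun n => Eventually.of_forall fun s hs => (norm_mul_le _ _).trans
      (mul_le_mul_of_nonneg_left (norm_picardTerm_le_of_mem hB n (Set.uIoc_subset_uIcc hs))
        (norm_nonneg _)))
    (Eventually.of_forall fun s _ => (Real.summable_pow_div_factorial _).mul_left _)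
    (by
      simp_rw [tsum_mul_left]
      exact (hB.norm_real.intervalIntegrable_real 0 t).mul_const _)
    (Eventually.of_forall fun s _ => (hasSum_picardTerm hB s).mul_left _)
  have h2 := (hasSum_nat_add_iff' 1).2 (hasSum_picardTerm hB t)
  simp only [Finset.sum_range_one] at h2
  have h3 := h2.unique h1
  rw [← h3]
  simp [picardTerm]

end Picard

/-! ### Measurability, cocycle identity and scalar perturbation -/

section PicardProperties

/-- The induction needs joint measurability, for the next integral over s. It follows from
measurability in ω at fixed t together with continuity in t. -/
theorem stronglyMeasurable_picardTerm {R : Type*} [NormedRing R] [NormedAlgebra ℝ R]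
    {Ω : Type*} [MeasurableSpace Ω] {B : Ω → ℝ → R} (hB : ∀ ω, LocallyIntegrable (B ω) volume)
    (hm : StronglyMeasurable (fun p : Ω × ℝ => B p.1 p.2)) (n : ℕ) :
    StronglyMeasurable (fun p : Ω × ℝ => picardTerm (B p.1) n p.2) := by
  induction n with
  | zero => exact stronglyMeasurable_const
  | succ n ih =>
    have h1 : ∀ t, StronglyMeasurable fun ω => picardTerm (B ω) (n + 1) t := by
      intro t
      simp only [picardTerm, intervalIntegral]
      exact (hm.mul ih).integral_prod_right'.sub (hm.mul ih).integral_prod_right'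
    have h2 := stronglyMeasurable_uncurry_of_continuous_of_stronglyMeasurable
      (u := fun (t : ℝ) ω => picardTerm (B ω) (n + 1) t)
      (fun ω => continuous_picardTerm (hB ω) (n + 1)) h1
    exact h2.comp_measurable measurable_swap

variable {R : Type*} [NormedRing R] [NormedAlgebra ℝ R] [NormOneClass R] [CompleteSpace R]
  {B : ℝ → R}

/-- A continuous solution of the integral equation `X = X₀ + ∫ B X` is a multiple of the Picard
series. -/
theorem eq_picardSeries_mul (hB : LocallyIntegrable B volume) {X : ℝ → R} {X₀ : R}
    (hX : Continuous X) (h : ∀ t, X t = X₀ + ∫ s in (0 : ℝ)..t, B s * X s) (t : ℝ) :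
    X t = picardSeries B t * X₀ := by
  have hc := continuous_picardSeries hB
  rw [← sub_eq_zero]
  refine eq_zero_of_norm_le_integral hB.norm_real (fun _ => norm_nonneg _)
    (x := fun t => X t - picardSeries B t * X₀)
    (f := fun s => B s * (X s - picardSeries B s * X₀)) (by fun_prop)
    (fun s => norm_mul_le _ _) (fun t => ?_) t
  simp_rw [mul_sub, ← mul_assoc]
  have hi := (hB.mul_continuous_real hc).intervalIntegrable_real 0 t
  have hmul := ((ContinuousLinearMap.mul ℝ R).flip X₀).intervalIntegral_comp_comm hi
  simp only [ContinuousLinearMap.flip_apply, ContinuousLinearMap.mul_apply'] at hmul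
  rw [intervalIntegral.integral_sub ((hB.mul_continuous_real hX).intervalIntegrable_real _ _)
      (hi.mul_const _), hmul, h t, picardSeries_eq hB t]
  noncomm_ring

theorem MeasureTheory.LocallyIntegrable.comp_add_right_real {F : Type*} [NormedAddCommGroup F]
    {f : ℝ → F} (hf : LocallyIntegrable f volume) (s : ℝ) :
    LocallyIntegrable (fun t => f (t + s)) volume := by
  rw [locallyIntegrable_iff]
  intro K hK
  obtain ⟨C, hC⟩ := hK.isBounded.exists_norm_le
  have h : IntervalIntegrable (fun t => f (t + s)) volume (-C) C :=
    by simpa using (hf.intervalIntegrable_real (-C + s) (C + s)).comp_add_right s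
  have hK' : IntegrableOn (fun t => f (t + s)) (Set.uIcc (-C) C) volume :=
    (intervalIntegrable_iff' (by finiteness)).1 h
  refine hK'.mono_set fun x hx => ?_
  have hx' := abs_le.1 (hC x hx)
  rw [Set.uIcc_of_le (by linarith)]
  exact hx'

/-- As functions of t, both sides solve the equation with coefficient shifted by s and value
`picardSeries B s` at time 0. -/
theorem picardSeries_add (hB : LocallyIntegrable B volume) (s t : ℝ) :
    picardSeries B (t + s) = picardSeries (fun r => B (r + s)) t * picardSeries B s := by
  have hc := continuous_picardSeries hB
  refine eq_picardSeries_mul (hB.comp_add_right_real s) (X := fun t => picardSeries B (t + s))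
    (by fun_prop) (fun t => ?_) t
  have hi := (hB.mul_continuous_real hc).intervalIntegrable_real
  rw [intervalIntegral.integral_comp_add_right (fun r => B r * picardSeries B r), zero_add,
    picardSeries_eq hB (t + s), picardSeries_eq hB s, add_assoc,
    intervalIntegral.integral_add_adjacent_intervals (hi _ _) (hi _ _)]

theorem picardSeries_zero (hB : LocallyIntegrable B volume) : picardSeries B 0 = 1 := by
  simpa using picardSeries_eq hB 0

theorem ae_hasDerivAt_picardSeries (hB : LocallyIntegrable B volume) :
    ∀ᵐ t, HasDerivAt (picardSeries B) (B t * picardSeries B t) t := by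
  have h : picardSeries B = fun t => 1 + ∫ s in (0 : ℝ)..t, B s * picardSeries B s :=
    funext (picardSeries_eq hB)
  filter_upwards [_root_.LocallyIntegrable.ae_hasDerivAt_integral
    (hB.mul_continuous_real (continuous_picardSeries hB))] with t ht
  rw [congrArg (fun f => HasDerivAt f (B t * picardSeries B t) t) h]
  exact (ht 0).const_add 1

theorem absolutelyContinuous_picardSeries (hB : LocallyIntegrable B volume) (a b : ℝ) :
    AbsolutelyContinuousOnInterval (picardSeries B) a b := by
  refine ((hB.mul_continuous_real
    (continuous_picardSeries hB)).absolutelyContinuous_primitive a b).of_dist_le fun x y => ?_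
  rw [picardSeries_eq hB x, picardSeries_eq hB y, dist_add_left]

theorem picardSeries_real {b : ℝ → ℝ} (hb : LocallyIntegrable b volume) (t : ℝ) :
    picardSeries b t = Real.exp (∫ s in (0 : ℝ)..t, b s) := by
  have h : ∀ n t, picardTerm b n t = (∫ s in (0 : ℝ)..t, b s) ^ n / n.factorial := by
    intro n
    induction n with
    | zero => intro t; simp [picardTerm]
    | succ n ih =>
      intro t
      simp only [picardTerm, ih, ← mul_div_assoc]
      rw [intervalIntegral.integral_div, integral_mul_primitive_pow hb, Nat.factorial_succ,
        div_div]
      push_cast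
      rfl
  simp only [picardSeries, h]
  rw [Real.exp_eq_exp_ℝ]
  exact (NormedSpace.expSeries_div_hasSum_exp _).tsum_eq

/-- Adding a scalar to the coefficient multiplies the solution by an exponential factor. -/
theorem picardSeries_add_smul_one (hB : LocallyIntegrable B volume) {c : ℝ → ℝ}
    (hc : LocallyIntegrable c volume) (t : ℝ) :
    picardSeries (fun s => B s + c s • (1 : R)) t
      = Real.exp (∫ s in (0 : ℝ)..t, c s) • picardSeries B t := by
  have hP : LocallyIntegrable (fun s => B s + c s • (1 : R)) volume :=
    hB.add fun t =>
    let ⟨s, hs, h⟩ := hc t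
    ⟨s, hs, Integrable.smul_const h 1⟩
  have hcont : Continuous fun t => picardSeries c t • picardSeries B t :=
    (continuous_picardSeries hc).smul (continuous_picardSeries hB)
  have h := eq_picardSeries_mul hP (X₀ := 1) hcont (fun t => ?_) t
  · rw [mul_one, picardSeries_real hc] at h
    exact h.symm
  · rw [integral_eq_sub_of_absolutelyContinuous
      (f := fun t => picardSeries c t • picardSeries B t)
      (fun a b => (absolutelyContinuous_picardSeries hc a b).fun_smul
        (absolutelyContinuous_picardSeries hB a b)) (hP.mul_continuous_real hcont)]
    · rw [picardSeries_zero hc, picardSeries_zero hB]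
      simp
    · filter_upwards [ae_hasDerivAt_picardSeries hB, ae_hasDerivAt_picardSeries hc] with t h1 h2
      refine (h2.fun_smul h1).congr_deriv ?_
      simp only [add_mul, smul_mul_assoc, mul_smul_comm, one_mul, smul_add, smul_smul]
      rw [mul_comm (c t)]

theorem stronglyMeasurable_picardSeries {Ω : Type*} [MeasurableSpace Ω] {B : Ω → ℝ → R}
    (hB : ∀ ω, LocallyIntegrable (B ω) volume)
    (hm : StronglyMeasurable (fun p : Ω × ℝ => B p.1 p.2)) (t : ℝ) :
    StronglyMeasurable (fun ω => picardSeries (B ω) t) := by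
  refine stronglyMeasurable_of_tendsto atTop
    (f := fun n ω => ∑ i ∈ Finset.range n, picardTerm (B ω) i t) (fun n => ?_)
    (tendsto_pi_nhds.2 fun ω => (hasSum_picardTerm (hB ω) t).tendsto_sum_nat)
  exact Finset.stronglyMeasurable_fun_sum _ fun i _ =>
    (stronglyMeasurable_picardTerm hB hm i).comp_measurable measurable_prodMk_right

end PicardProperties

/-! ### Carathéodory solutions and the solution operator -/

section Caratheodory

variable {E : Type*} [NormedAddCommGroup E] [NormedSpace ℝ E]

theorem MeasureTheory.LocallyIntegrable.clm_apply_continuous {B : ℝ → E →L[ℝ] E}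
    (hB : LocallyIntegrable B volume) {x : ℝ → E} (hx : Continuous x) :
    LocallyIntegrable (fun s => B s (x s)) volume := by
  refine (hB.norm_real.mul_continuous_real hx.norm).mono ?_ (Eventually.of_forall fun s => ?_)
  · exact isBoundedBilinearMap_apply.continuous.comp_aestronglyMeasurable
      (hB.aestronglyMeasurable.prodMk hx.aestronglyMeasurable)
  · rw [Real.norm_of_nonneg (by positivity)]
    exact (B s).le_opNorm _

variable {N : ℕ} {B : ℝ → Matrix (Fin N) (Fin N) ℝ}

theorem IsCaratheodorySolution.continuous {x₀ : EuclideanSpace ℝ (Fin N)}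
    {x : ℝ → EuclideanSpace ℝ (Fin N)} (hx : IsCaratheodorySolution B x₀ x) : Continuous x := by
  rw [continuous_iff_continuousAt]
  intro t
  have h := (hx.absolutelyContinuous (t - 1) (t + 1)).continuousOn
  rw [Set.uIcc_of_le (by linarith)] at h
  exact h.continuousAt (Icc_mem_nhds (by linarith) (by linarith))

theorem IsCaratheodorySolution.unique
    (hB : LocallyIntegrable (fun t => Matrix.toEuclideanCLM (𝕜 := ℝ) (B t)) volume)
    {x₀ : EuclideanSpace ℝ (Fin N)} {x y : ℝ → EuclideanSpace ℝ (Fin N)}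
    (hx : IsCaratheodorySolution B x₀ x) (hy : IsCaratheodorySolution B x₀ y) : x = y := by
  funext t
  rw [← sub_eq_zero]
  have hc : Continuous fun t => x t - y t := hx.continuous.sub hy.continuous
  refine eq_zero_of_norm_le_integral hB.norm_real (fun _ => norm_nonneg _)
    (x := fun t => x t - y t)
    (f := fun s => Matrix.toEuclideanCLM (𝕜 := ℝ) (B s) (x s - y s)) hc
    (fun s => ContinuousLinearMap.le_opNorm _ _) (fun t => ?_) t
  rw [integral_eq_sub_of_absolutelyContinuous (f := fun t => x t - y t)
    (fun a b => (hx.absolutelyContinuous a b).fun_sub (hy.absolutelyContinuous a b))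
    (hB.clm_apply_continuous hc)]
  · simp [hx.initial, hy.initial]
  · filter_upwards [hx.equation, hy.equation] with t h1 h2
    rw [map_sub]
    exact h1.fun_sub h2

theorem IsSolutionOperator.picardSeries [NeZero N]
    (hB : LocallyIntegrable (fun t => Matrix.toEuclideanCLM (𝕜 := ℝ) (B t)) volume) :
    IsSolutionOperator B (picardSeries fun t => Matrix.toEuclideanCLM (𝕜 := ℝ) (B t)) := by
  intro x₀
  refine ⟨fun a b => ?_, ?_, ?_⟩
  · refine ((absolutelyContinuous_picardSeries hB a b).const_smul
      ‖x₀‖).of_dist_le fun x y => ?_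
    rw [dist_smul₀, dist_eq_norm, dist_eq_norm, ← sub_apply, norm_norm,
      mul_comm]
    exact ContinuousLinearMap.le_opNorm _ _
  · simp [picardSeries_zero hB]
  · filter_upwards [ae_hasDerivAt_picardSeries hB] with t ht
    exact ((ContinuousLinearMap.apply ℝ _ x₀).hasFDerivAt.comp_hasDerivAt t ht)

theorem IsSolutionOperator.congr {B' : ℝ → Matrix (Fin N) (Fin N) ℝ} (h : ∀ᵐ t, B t = B' t)
    {U : ℝ → EuclideanSpace ℝ (Fin N) →L[ℝ] EuclideanSpace ℝ (Fin N)}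
    (hU : IsSolutionOperator B U) : IsSolutionOperator B' U := by
  refine fun x₀ => ⟨(hU x₀).absolutelyContinuous, (hU x₀).initial, ?_⟩
  filter_upwards [h, (hU x₀).equation] with t h1 h2
  rwa [← h1]

/-- B' itself need not be the regular coefficient: the equation holds only almost everywhere in t,
so B' and its modification B have the same solutions. -/
theorem existsUnique_isSolutionOperator [NeZero N] {B' : ℝ → Matrix (Fin N) (Fin N) ℝ}
    (hB : LocallyIntegrable (fun t => Matrix.toEuclideanCLM (𝕜 := ℝ) (B t)) volume)
    (h : ∀ᵐ t, B' t = B t) : ∃! U, IsSolutionOperator B' U := by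
  refine ⟨picardSeries fun t => Matrix.toEuclideanCLM (𝕜 := ℝ) (B t),
    (IsSolutionOperator.picardSeries hB).congr (h.mono fun t ht => ht.symm), fun V hV => ?_⟩
  funext t
  ext1 x₀
  exact congrFun (((hV.congr h) x₀).unique hB (IsSolutionOperator.picardSeries hB x₀)) t

theorem solutionOperator_eq_picardSeries [NeZero N] {B' : ℝ → Matrix (Fin N) (Fin N) ℝ}
    (hB : LocallyIntegrable (fun t => Matrix.toEuclideanCLM (𝕜 := ℝ) (B t)) volume)
    (h : ∀ᵐ t, B' t = B t) :
    solutionOperator B' = picardSeries fun t => Matrix.toEuclideanCLM (𝕜 := ℝ) (B t) := by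
  have hU := existsUnique_isSolutionOperator hB h
  exact hU.unique (Classical.epsilon_spec hU.exists)
    ((IsSolutionOperator.picardSeries hB).congr (h.mono fun t ht => ht.symm))

end Caratheodory

theorem IsFlowInvariant.mem_iff {Ω : Type*} {θ : ℝ → Ω → Ω} {F : Set Ω}
    (hF : IsFlowInvariant θ F) (t : ℝ) (ω : Ω) : θ t ω ∈ F ↔ ω ∈ F :=
  Set.ext_iff.1 (hF t) ω

/-! ### Null sets, invariant sets and integrals along orbits -/

section Flow

variable {Ω : Type*} [MeasurableSpace Ω] {μ : Measure Ω} {θ : ℝ → Ω → Ω}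

namespace IsMeasurePreservingFlow

theorem measurable_orbit (hθ : IsMeasurePreservingFlow μ θ) :
    Measurable (fun p : Ω × ℝ => θ p.2 p.1) :=
  hθ.measurable.comp measurable_swap

/-- Fubini: at each fixed t the preimage of a null set under θ_t is null. The measurable superset is
needed because p may fail to be measurable. -/
theorem ae_ae_orbit [SFinite μ] (hθ : IsMeasurePreservingFlow μ θ) {p : Ω → Prop}
    (hp : ∀ᵐ ω ∂μ, p ω) : ∀ᵐ ω ∂μ, ∀ᵐ t : ℝ, p (θ t ω) := by
  obtain ⟨B, hB, hBm, hB0⟩ := exists_measurable_superset_of_null (ae_iff.1 hp)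
  have h : ∀ᵐ ω ∂μ, ∀ᵐ t : ℝ, θ t ω ∉ B := by
    rw [Measure.ae_ae_comm (hθ.measurable_orbit hBm).compl]
    refine Eventually.of_forall fun t => ?_
    have := (hθ.measurePreserving t).measure_preimage hBm.nullMeasurableSet
    rw [hB0] at this
    exact measure_eq_zero_iff_ae_notMem.1 this
  refine h.mono fun ω hω => hω.mono fun t ht => ?_
  by_contra hc
  exact ht (hB hc)

theorem measurableSet_ae_orbit_mem (hθ : IsMeasurePreservingFlow μ θ) {E : Set Ω}
    (hE : MeasurableSet E) : MeasurableSet {ω | ∀ᵐ t : ℝ, θ t ω ∈ E} := by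
  have h := measurable_measure_prodMk_left (ν := (volume : Measure ℝ))
    (hθ.measurable_orbit hE.compl)
  exact h (measurableSet_singleton 0)

/-- Starting from θ_s ω translates the time variable, and Lebesgue null sets are translation
invariant. So any set E yields an exactly invariant one. -/
theorem isFlowInvariant_ae_orbit (hθ : IsMeasurePreservingFlow μ θ) (E : Set Ω) :
    IsFlowInvariant θ {ω | ∀ᵐ t : ℝ, θ t ω ∈ E} := by
  intro s
  ext ω
  change (∀ᵐ t : ℝ, θ t (θ s ω) ∈ E) ↔ ∀ᵐ t : ℝ, θ t ω ∈ E
  simp_rw [← hθ.map_add]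
  conv_rhs => rw [← (measurePreserving_add_left (volume : Measure ℝ) s).map_eq]
  exact (MeasurableEmbedding.ae_map_iff (f := fun x => s + x) (p := fun t => θ t ω ∈ E)
    (MeasurableEquiv.addLeft s).measurableEmbedding).symm

/-- A property that holds almost surely holds at almost all times along the orbits starting in an
invariant measurable set of full measure. -/
theorem exists_invariant_ae_orbit [IsProbabilityMeasure μ] (hθ : IsMeasurePreservingFlow μ θ)
    {p : Ω → Prop} (hp : ∀ᵐ ω ∂μ, p ω) :
    ∃ F : Set Ω, MeasurableSet F ∧ IsFlowInvariant θ F ∧ μ F = 1 ∧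
      ∀ ω ∈ F, ∀ᵐ t : ℝ, p (θ t ω) := by
  obtain ⟨B, hB, hBm, hB0⟩ := exists_measurable_superset_of_null (ae_iff.1 hp)
  have hm := hθ.measurableSet_ae_orbit_mem hBm.compl
  refine ⟨_, hm, hθ.isFlowInvariant_ae_orbit _, ?_,
    fun ω (hω : ∀ᵐ t : ℝ, θ t ω ∈ Bᶜ) => hω.mono fun t ht => ?_⟩
  · rw [← mem_ae_iff_prob_eq_one hm]
    exact hθ.ae_ae_orbit (measure_eq_zero_iff_ae_notMem.1 hB0)
  · by_contra hc
    exact ht (hB hc)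

end IsMeasurePreservingFlow

/-- Ergodicity is assumed only for measurable, exactly invariant sets. Almost-all-times membership
in a measurable E equal to F almost everywhere defines such a set, and it agrees with F up to a null
set. -/
theorem IsErgodicFlow.measure_eq_zero_or_one [IsProbabilityMeasure μ] (hθ : IsErgodicFlow μ θ)
    {F : Set Ω} (hF : IsFlowInvariant θ F) (hm : NullMeasurableSet F μ) :
    μ F = 0 ∨ μ F = 1 := by
  obtain ⟨E, -, hE, hEF⟩ := hm.exists_measurable_superset_ae_eq
  have hae : {ω | ∀ᵐ t : ℝ, θ t ω ∈ E} =ᵐ[μ] F := by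
    filter_upwards [hθ.ae_ae_orbit hEF] with ω hω
    refine propext ?_
    have h : ∀ᵐ t : ℝ, (θ t ω ∈ E ↔ ω ∈ F) := by
      filter_upwards [hω] with t ht
      rw [← hF.mem_iff t ω]
      exact iff_of_eq ht
    exact (eventually_congr h).trans eventually_const
  rw [← measure_congr hae]
  exact hθ.ergodic _ (hθ.measurableSet_ae_orbit_mem hE) (hθ.isFlowInvariant_ae_orbit E)

namespace IsMeasurePreservingFlow

theorem orbit_add (hθ : IsMeasurePreservingFlow μ θ) {F : Type*} (g : Ω → F) (s : ℝ) (ω : Ω) :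
    (fun t => g (θ t (θ s ω))) = fun t => g (θ (t + s) ω) := by
  funext t
  rw [add_comm, hθ.map_add]

theorem integral_orbit_comp (hθ : IsMeasurePreservingFlow μ θ) (g : Ω → ℝ) (s a b : ℝ) (ω : Ω) :
    ∫ r in a..b, g (θ r (θ s ω)) = ∫ r in (a + s)..(b + s), g (θ r ω) := by
  rw [hθ.orbit_add, intervalIntegral.integral_comp_add_right (fun r => g (θ r ω))]

theorem iterate_eq (hθ : IsMeasurePreservingFlow μ θ) (s : ℝ) (n : ℕ) :
    (θ s)^[n] = θ (n * s) := by
  induction n with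
  | zero => funext ω; simp [hθ.map_zero]
  | succ n ih =>
    funext ω
    rw [Function.iterate_succ_apply', ih, ← hθ.map_add]
    push_cast
    ring_nf

variable {F : Type*} [NormedAddCommGroup F]

theorem integrable_orbit_prod [IsFiniteMeasure μ] (hθ : IsMeasurePreservingFlow μ θ) {g : Ω → F}
    (hgm : StronglyMeasurable g) (hg : Integrable g μ) (a b : ℝ) :
    Integrable (fun p : Ω × ℝ => g (θ p.2 p.1)) (μ.prod (volume.restrict (Set.Ioc a b))) := by
  have hm : AEStronglyMeasurable (fun p : Ω × ℝ => g (θ p.2 p.1))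
      (μ.prod (volume.restrict (Set.Ioc a b))) :=
    (hgm.comp_measurable hθ.measurable_orbit).aestronglyMeasurable
  refine (integrable_prod_iff' hm).2 ⟨Eventually.of_forall fun t => ?_, ?_⟩
  · exact ((hθ.measurePreserving t).integrable_comp hgm.aestronglyMeasurable).2 hg
  · have h : ∀ t, ∫ ω, ‖g (θ t ω)‖ ∂μ = ∫ ω, ‖g ω‖ ∂μ := fun t => by
      conv_rhs => rw [← (hθ.measurePreserving t).map_eq]
      rw [integral_map (hθ.measurePreserving t).aemeasurable
        hgm.norm.aestronglyMeasurable]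
    simp only [h]
    exact integrable_const _

theorem ae_locallyIntegrable_orbit [IsFiniteMeasure μ] (hθ : IsMeasurePreservingFlow μ θ)
    {g : Ω → F} (hgm : StronglyMeasurable g) (hg : Integrable g μ) :
    ∀ᵐ ω ∂μ, LocallyIntegrable (fun t => g (θ t ω)) volume := by
  have h : ∀ᵐ ω ∂μ, ∀ n : ℕ, IntegrableOn (fun t => g (θ t ω)) (Set.Ioc (-n : ℝ) n) volume :=
    ae_all_iff.2 fun n => (hθ.integrable_orbit_prod hgm hg _ _).prod_right_ae
  filter_upwards [h] with ω hω
  intro t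
  obtain ⟨n, hn⟩ := exists_nat_gt |t|
  exact ⟨_, Ioc_mem_nhds (by linarith [neg_abs_le t]) (by linarith [le_abs_self t]), hω n⟩

theorem integrable_integral_orbit [IsFiniteMeasure μ] (hθ : IsMeasurePreservingFlow μ θ)
    {g : Ω → ℝ} (hgm : StronglyMeasurable g) (hg : Integrable g μ) (t : ℝ) :
    Integrable (fun ω => ∫ s in (0 : ℝ)..t, g (θ s ω)) μ :=
  (hθ.integrable_orbit_prod hgm hg 0 t).integral_prod_left.sub
    (hθ.integrable_orbit_prod hgm hg t 0).integral_prod_left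

theorem integral_integral_orbit [IsFiniteMeasure μ] (hθ : IsMeasurePreservingFlow μ θ)
    {g : Ω → ℝ} (hgm : StronglyMeasurable g) (hg : Integrable g μ) {t : ℝ} (ht : 0 ≤ t) :
    ∫ ω, (∫ s in (0 : ℝ)..t, g (θ s ω)) ∂μ = t * ∫ ω, g ω ∂μ := by
  simp_rw [intervalIntegral.integral_of_le ht]
  rw [integral_integral_swap (hθ.integrable_orbit_prod hgm hg 0 t)]
  have h : ∀ t, ∫ ω, g (θ t ω) ∂μ = ∫ ω, g ω ∂μ := fun t => by
    conv_rhs => rw [← (hθ.measurePreserving t).map_eq]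
    rw [integral_map (hθ.measurePreserving t).aemeasurable hgm.aestronglyMeasurable]
  simp [h, ht]

end IsMeasurePreservingFlow

/-- An integrable random ML-matrix has a version that is measurable and locally integrable along
every orbit. -/
theorem exists_regular_version [IsProbabilityMeasure μ] (hθ : IsMeasurePreservingFlow μ θ) {N : ℕ}
    {A : Ω → Matrix (Fin N) (Fin N) ℝ} (hA0 : ∀ i j, Integrable (fun ω => A ω i j) μ)
    (hA1 : ∀ ω, IsMLMatrix (A ω)) :
    ∃ A' : Ω → Matrix (Fin N) (Fin N) ℝ,
      (∀ i j, StronglyMeasurable fun ω => A' ω i j) ∧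
      (∀ ω, IsMLMatrix (A' ω)) ∧
      (∀ ω i j, LocallyIntegrable (fun t => A' (θ t ω) i j) volume) ∧
      ∀ᵐ ω ∂μ, A ω = A' ω := by
  classical
  have hmk : ∀ᵐ ω ∂μ, ∀ i j, A ω i j = (hA0 i j).1.mk _ ω :=
    ae_all_iff.2 fun i => ae_all_iff.2 fun j => (hA0 i j).1.ae_eq_mk
  obtain ⟨B, hB, hBm, hB0⟩ := exists_measurable_superset_of_null (ae_iff.1 hmk)
  have hB' : ∀ ω, ω ∉ B → ∀ i j, A ω i j = (hA0 i j).1.mk _ ω := fun ω hω => by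
    by_contra hc
    exact hω (hB hc)
  -- The value zero on the exceptional set keeps the sign condition valid at every ω.
  let A₁ : Ω → Matrix (Fin N) (Fin N) ℝ := fun ω i j =>
    Bᶜ.indicator ((hA0 i j).1.mk fun ω => A ω i j) ω
  have hA₁ : ∀ᵐ ω ∂μ, A ω = A₁ ω := by
    filter_upwards [measure_eq_zero_iff_ae_notMem.1 hB0] with ω hω
    ext i j
    rw [hB' ω hω i j]
    exact (Set.indicator_of_mem (show ω ∈ Bᶜ from hω) _).symm
  have hA₁m : ∀ i j, StronglyMeasurable fun ω => A₁ ω i j := fun i j =>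
    (hA0 i j).1.stronglyMeasurable_mk.indicator hBm.compl
  have hA₁ml : ∀ ω, IsMLMatrix (A₁ ω) := by
    intro ω i j hij
    by_cases hω : ω ∈ B
    · exact (Set.indicator_of_notMem (by simpa using hω) _).ge
    · rw [show A₁ ω i j = (hA0 i j).1.mk _ ω from Set.indicator_of_mem (by simpa using hω) _,
        ← hB' ω hω]
      exact hA1 ω i j hij
  have hint : ∀ i j, Integrable (fun ω => A₁ ω i j) μ := fun i j =>
    (hA0 i j).congr (hA₁.mono fun ω hω => congrFun (congrFun hω i) j)
  obtain ⟨F, hFm, hFi, hF1, hF⟩ := hθ.exists_invariant_ae_orbit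
    (ae_all_iff.2 fun i => ae_all_iff.2 fun j =>
      hθ.ae_locallyIntegrable_orbit (hA₁m i j) (hint i j))
  have hloc : ∀ ω ∈ F, ∀ i j, LocallyIntegrable (fun t => A₁ (θ t ω) i j) volume := by
    intro ω hω i j
    -- Local integrability is known only from some point θ_s ω of the orbit; shifting time by -s
    -- carries it back to ω.
    obtain ⟨s, hs⟩ := (hF ω hω).exists
    have := (hs i j).comp_add_right_real (-s)
    simpa [← hθ.map_add] using this
  refine ⟨fun ω i j => F.indicator (fun ω => A₁ ω i j) ω, fun i j => (hA₁m i j).indicator hFm,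
    fun ω i j hij => ?_, fun ω i j => ?_, ?_⟩
  · exact Set.indicator_nonneg (f := fun ω => A₁ ω i j) (fun ω _ => hA₁ml ω i j hij) ω
  · by_cases hω : ω ∈ F
    · simpa [Set.indicator, hFi.mem_iff, hω] using hloc ω hω i j
    · simpa [Set.indicator, hFi.mem_iff, hω] using
        (locallyIntegrable_const (0 : ℝ) : LocallyIntegrable _ (volume : Measure ℝ))
  · filter_upwards [hA₁, (mem_ae_iff_prob_eq_one hFm).2 hF1] with ω h1 h2
    rw [h1]
    ext i j
    exact (Set.indicator_of_mem h2 fun ω => A₁ ω i j).symm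

end Flow

/-- The pointwise stopping time estimate behind `le_of_subadditive_of_ae_exists_le`. -/
theorem subadditive_le_sum_of_stopping {Ω : Type*} {T : Ω → Ω} {φ : ℕ → Ω → ℝ} (h0 : ∀ ω, φ 0 ω = 0)
    (hsub : ∀ m n ω, φ (m + n) ω ≤ φ m ω + φ n (T^[m] ω)) {M : ℕ} {b : Ω → ℝ}
    (hb0 : ∀ ω, 0 ≤ b ω)
    (hb : ∀ ω, (∃ k, 1 ≤ k ∧ k ≤ M ∧ φ k ω ≤ 0) ∨ |φ 1 ω| ≤ b ω) (n : ℕ) (ω : Ω) :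
    φ n ω ≤ ∑ j ∈ Finset.range n,
      (b (T^[j] ω) + if n - j ≤ M then |φ 1 (T^[j] ω)| else 0) := by
  have hpos : ∀ (n j : ℕ) ω, 0 ≤ b (T^[j] ω) + if n - j ≤ M then |φ 1 (T^[j] ω)| else 0 := by
    intro n j ω
    have := hb0 (T^[j] ω)
    split_ifs <;> positivity
  induction n using Nat.strong_induction_on generalizing ω with
  | _ n ih =>
    have step : ∀ k, 1 ≤ k → k ≤ n → φ k ω ≤ ∑ j ∈ Finset.range k,
        (b (T^[j] ω) + if n - j ≤ M then |φ 1 (T^[j] ω)| else 0) →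
        φ n ω ≤ ∑ j ∈ Finset.range n,
          (b (T^[j] ω) + if n - j ≤ M then |φ 1 (T^[j] ω)| else 0) := by
      intro k hk1 hkn hk
      have h1 := hsub k (n - k) ω
      rw [Nat.add_sub_cancel' hkn] at h1
      have h2 := ih (n - k) (by omega) (T^[k] ω)
      have h3 := Finset.sum_range_add
        (fun j => b (T^[j] ω) + if n - j ≤ M then |φ 1 (T^[j] ω)| else 0) k (n - k)
      rw [Nat.add_sub_cancel' hkn] at h3
      rw [h3]
      refine h1.trans (add_le_add hk (h2.trans_eq (Finset.sum_congr rfl fun j _ => ?_)))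
      rw [← Function.iterate_add_apply, add_comm j k, Nat.sub_sub]
    rcases Nat.eq_zero_or_pos n with rfl | hn
    · simp [h0]
    -- In the last M times a stopping block could reach beyond n, so the orbit advances by single
    -- steps there, each paid for by |φ 1|.
    by_cases hnM : n ≤ M
    · refine step 1 le_rfl hn ?_
      simp only [Finset.sum_range_one, Function.iterate_zero, id, Nat.sub_zero, if_pos hnM]
      exact (le_abs_self _).trans (le_add_of_nonneg_left (hb0 ω))
    · rcases hb ω with ⟨k, hk1, hkM, hk⟩ | h
      · exact step k hk1 (by omega) (hk.trans (Finset.sum_nonneg fun j _ => hpos n j ω))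
      · refine step 1 le_rfl hn ?_
        simp only [Finset.sum_range_one, Function.iterate_zero, id, Nat.sub_zero, if_neg hnM,
          add_zero]
        exact (le_abs_self _).trans h

/-! ### The maximal inequality for a measure-preserving map -/

section Subadditive

variable {Ω : Type*} [MeasurableSpace Ω] {μ : Measure Ω}

theorem MeasureTheory.MeasurePreserving.integral_comp_real {T : Ω → Ω}
    (hT : MeasurePreserving T μ μ) {g : Ω → ℝ} (hg : AEStronglyMeasurable g μ) :
    ∫ ω, g (T ω) ∂μ = ∫ ω, g ω ∂μ := by
  conv_rhs => rw [← hT.map_eq]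
  rw [integral_map hT.aemeasurable (by rwa [hT.map_eq])]

theorem le_integral_of_stopping [IsFiniteMeasure μ] {T : Ω → Ω} (hT : MeasurePreserving T μ μ)
    {φ : ℕ → Ω → ℝ} (h0 : ∀ ω, φ 0 ω = 0)
    (hsub : ∀ m n ω, φ (m + n) ω ≤ φ m ω + φ n (T^[m] ω))
    (hint : ∀ n, Integrable (φ n) μ) {M : ℕ} {b : Ω → ℝ}
    (hb0 : ∀ ω, 0 ≤ b ω) (hbi : Integrable b μ)
    (hb : ∀ ω, (∃ k, 1 ≤ k ∧ k ≤ M ∧ φ k ω ≤ 0) ∨ |φ 1 ω| ≤ b ω)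
    {γ : ℝ} (hγ : ∀ n : ℕ, n * γ ≤ ∫ ω, φ n ω ∂μ) : γ ≤ ∫ ω, b ω ∂μ := by
  have hTn := fun n => hT.iterate n
  -- In the reversed order i = n - 1 - j the expectation of the j-th summand no longer depends on n.
  -- Only the first M values of u can differ from ∫ b, so the Cesàro means tend to ∫ b.
  let u : ℕ → ℝ := fun i => (∫ ω, b ω ∂μ) + if i + 1 ≤ M then ∫ ω, |φ 1 ω| ∂μ else 0
  have hu : Tendsto u atTop (𝓝 (∫ ω, b ω ∂μ)) := by
    refine tendsto_const_nhds.congr' ?_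
    filter_upwards [eventually_ge_atTop M] with i hi
    simp only [u, if_neg (show ¬ i + 1 ≤ M by omega), add_zero]
  refine ge_of_tendsto hu.cesaro ?_
  filter_upwards [eventually_gt_atTop 0] with n hn
  have hn' : (0 : ℝ) < n := by exact_mod_cast hn
  rw [← div_eq_inv_mul, le_div_iff₀ hn', mul_comm]
  refine (hγ n).trans ?_
  have hbT : ∀ j, Integrable (fun ω => b (T^[j] ω)) μ := fun j =>
    ((hTn j).integrable_comp hbi.1).2 hbi
  have hφT : ∀ j, Integrable (fun ω => if n - j ≤ M then |φ 1 (T^[j] ω)| else 0) μ := by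
    intro j
    split_ifs
    · exact ((hTn j).integrable_comp (hint 1).abs.1).2 (hint 1).abs
    · exact integrable_zero _ _ _
  refine (integral_mono (hint n) (integrable_finsetSum _ fun j _ => (hbT j).add (hφT j))
    (subadditive_le_sum_of_stopping h0 hsub hb0 hb n)).trans_eq ?_
  rw [integral_finsetSum _ fun j _ => (hbT j).add (hφT j), ← Finset.sum_range_reflect]
  refine Finset.sum_congr rfl fun j hj => ?_
  have hjn := Finset.mem_range.1 hj
  rw [integral_add' (hbT _) (hφT _), (hTn _).integral_comp_real hbi.1]
  have h1 : n - (n - 1 - j) = j + 1 := by omega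
  simp only [h1, u]
  congr 1
  split_ifs
  · exact (hTn _).integral_comp_real (hint 1).abs.1
  · simp

/-- A subadditive version of the maximal ergodic theorem. -/
theorem le_of_subadditive_of_ae_exists_le [IsProbabilityMeasure μ] {T : Ω → Ω}
    (hT : MeasurePreserving T μ μ) {f : ℕ → Ω → ℝ} (h0 : ∀ ω, f 0 ω = 0)
    (hsub : ∀ m n ω, f (m + n) ω ≤ f m ω + f n (T^[m] ω))
    (hm : ∀ n, Measurable (f n)) (hint : ∀ n, Integrable (f n) μ) {c γ : ℝ}
    (hγ : ∀ n : ℕ, n * γ ≤ ∫ ω, f n ω ∂μ)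
    (hc : ∀ᵐ ω ∂μ, ∃ n : ℕ, 1 ≤ n ∧ f n ω ≤ n * c) : γ ≤ c := by
  let φ : ℕ → Ω → ℝ := fun n ω => f n ω - n * c
  have hφi : ∀ n, Integrable (φ n) μ := fun n => (hint n).sub (integrable_const _)
  have hφm : ∀ n, Measurable (φ n) := fun n => (hm n).sub measurable_const
  let S : ℕ → Set Ω := fun M => {ω | ∃ k, 1 ≤ k ∧ k ≤ M ∧ φ k ω ≤ 0}
  have hS : ∀ M, MeasurableSet (S M) := by
    intro M
    have : S M = ⋃ k, ⋃ (_ : 1 ≤ k ∧ k ≤ M), {ω | φ k ω ≤ 0} := by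
      ext ω; simp [S, and_assoc]
    rw [this]
    exact MeasurableSet.iUnion fun k => MeasurableSet.iUnion fun _ =>
      measurableSet_le (hφm k) measurable_const
  -- A single step is charged only where no φ k with 1 ≤ k ≤ M is nonpositive. By `hc` this set
  -- shrinks to a null set as M grows.
  let b : ℕ → Ω → ℝ := fun M => (S M)ᶜ.indicator fun ω => |φ 1 ω|
  have hbound : ∀ M, γ - c ≤ ∫ ω, b M ω ∂μ := by
    intro M
    refine le_integral_of_stopping hT (φ := φ) (M := M) (fun ω => by simp [φ, h0])
      (fun m n ω => ?_) hφi (fun ω => Set.indicator_nonneg (fun _ _ => abs_nonneg _) ω)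
      ((hφi 1).abs.indicator (hS M).compl) (fun ω => ?_) fun n => ?_
    · have := hsub m n ω
      simp only [φ]
      push_cast
      linarith
    · by_cases h : ω ∈ S M
      · exact Or.inl h
      · exact Or.inr (Set.indicator_of_mem (show ω ∈ (S M)ᶜ from h) fun ω => |φ 1 ω|).ge
    · rw [integral_sub (hint n) (integrable_const _), integral_const]
      simpa [mul_sub] using hγ n
  have hlim : Tendsto (fun M => ∫ ω, b M ω ∂μ) atTop (𝓝 (∫ _, (0 : ℝ) ∂μ)) := by
    refine tendsto_integral_of_dominated_convergence (fun ω => |φ 1 ω|)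
      (fun M => ((hφi 1).abs.indicator (hS M).compl).1) (hφi 1).abs
      (fun M => Eventually.of_forall fun ω => ?_) ?_
    · rw [Real.norm_of_nonneg (Set.indicator_nonneg (fun _ _ => abs_nonneg _) ω)]
      exact Set.indicator_le_self' (fun _ _ => abs_nonneg _) ω
    · filter_upwards [hc] with ω ⟨n, hn1, hn⟩
      refine tendsto_const_nhds.congr' ?_
      filter_upwards [eventually_ge_atTop n] with M hM
      refine (Set.indicator_of_notMem ?_ _).symm
      exact fun h => h ⟨n, hn1, hM, sub_nonpos.2 hn⟩
  simpa using ge_of_tendsto' hlim hbound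

/-- Borel–Cantelli: integrability makes the probabilities of |X| (k + 1) > n summable in n, and X ∘
T^n has the law of X. -/
theorem ae_tendsto_iterate_div_zero [IsProbabilityMeasure μ] {T : Ω → Ω}
    (hT : MeasurePreserving T μ μ) {X : Ω → ℝ} (hX : Integrable X μ) :
    ∀ᵐ ω ∂μ, Tendsto (fun n : ℕ => X (T^[n] ω) / n) atTop (𝓝 0) := by
  have h : ∀ k : ℕ, ∀ᵐ ω ∂μ, ∀ᶠ n : ℕ in atTop, |X (T^[n] ω)| * (k + 1) ≤ n := by
    intro k
    let Y : Ω → ℝ := fun ω => |X ω| * (k + 1)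
    have hY : Integrable Y μ := hX.abs.mul_const _
    let _ : MeasureSpace Ω := ⟨μ⟩
    have hsum := ProbabilityTheory.tsum_prob_mem_Ioi_lt_top (X := Y) hY
      fun ω => by positivity
    have hnull : ∀ n : ℕ, NullMeasurableSet {ω | Y ω ∈ Set.Ioi (n : ℝ)} μ := fun n =>
      nullMeasurableSet_lt aemeasurable_const hY.1.aemeasurable
    have heq : ∀ n : ℕ, μ {ω | Y (T^[n] ω) ∈ Set.Ioi (n : ℝ)} = μ {ω | Y ω ∈ Set.Ioi (n : ℝ)} :=
      fun n => (hT.iterate n).measure_preimage (hnull n)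
    have hbc := ae_eventually_notMem (μ := μ)
      (s := fun n : ℕ => {ω | Y (T^[n] ω) ∈ Set.Ioi (n : ℝ)})
      (by simp only [heq]; exact hsum.ne)
    refine hbc.mono fun ω hω => hω.mono fun n hn => ?_
    simpa [Y] using hn
  filter_upwards [ae_all_iff.2 h] with ω hω
  rw [Metric.tendsto_nhds]
  intro ε hε
  obtain ⟨k, hk⟩ := exists_nat_one_div_lt hε
  filter_upwards [hω k, eventually_gt_atTop 0] with n hn hn0
  have hn' : (0 : ℝ) < n := by exact_mod_cast hn0
  rw [dist_zero_right, norm_div, Real.norm_eq_abs, Real.norm_of_nonneg hn'.le]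
  refine lt_of_le_of_lt ?_ hk
  rw [div_le_div_iff₀ hn' (by positivity), one_mul]
  exact hn

end Subadditive

/-! ### The subadditive ergodic theorem over an ergodic flow -/

section SubadditiveFlow

variable {Ω : Type*} [MeasurableSpace Ω] {μ : Measure Ω} {θ : ℝ → Ω → Ω}

/-- A sequence of functions that is asymptotically invariant along the orbits of an ergodic flow
has an almost surely constant lower limit. -/
theorem IsErgodicFlow.ae_frequently_lt_or_ae_eventually_le [IsProbabilityMeasure μ]
    (hθ : IsErgodicFlow μ θ) {W : Set Ω} (hW : IsFlowInvariant θ W)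
    (hWae : ∀ᵐ ω ∂μ, ω ∈ W) {h : ℕ → Ω → ℝ} (hm : ∀ n, Measurable (h n))
    (hinv : ∀ ω ∈ W, ∀ s, Tendsto (fun n => h n (θ s ω) - h n ω) atTop (𝓝 0)) (c : ℝ) :
    (∀ᵐ ω ∂μ, ∀ c' > c, ∃ᶠ n in atTop, h n ω < c') ∨
      ∀ᵐ ω ∂μ, ∃ c' > c, ∀ᶠ n in atTop, c' ≤ h n ω := by
  -- Membership in W makes F exactly invariant. As W is not assumed measurable, F is shown only to
  -- be null-measurable.
  let F : Set Ω := {ω | ω ∈ W ∧ ∀ c' > c, ∃ᶠ n in atTop, h n ω < c'}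
  have hstep : ∀ ω ∈ W, ∀ s, (∀ c' > c, ∃ᶠ n in atTop, h n ω < c') →
      ∀ c' > c, ∃ᶠ n in atTop, h n (θ s ω) < c' := by
    intro ω hω s hF c' hc'
    have h1 := hF ((c + c') / 2) (by linarith)
    have h2 := (hinv ω hω s).eventually_lt_const (show (0 : ℝ) < (c' - c) / 2 by linarith)
    exact (h1.and_eventually h2).mono fun n hn => by linarith [hn.1, hn.2]
  have hFinv : IsFlowInvariant θ F := by
    intro s
    ext ω
    refine ⟨fun ⟨h1, h2⟩ => ?_, fun ⟨h1, h2⟩ => ⟨(hW.mem_iff s ω).2 h1, hstep ω h1 s h2⟩⟩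
    refine ⟨(hW.mem_iff s ω).1 h1, ?_⟩
    have := hstep (θ s ω) h1 (-s) h2
    rwa [← hθ.map_add, add_neg_cancel, hθ.map_zero] at this
  have hFeq : F =ᵐ[μ] ⋂ k : ℕ, ⋂ m : ℕ, ⋃ n : ℕ, ⋃ (_ : m ≤ n),
      {ω | h n ω < c + 1 / (k + 1)} := by
    filter_upwards [hWae] with ω hω
    refine propext ?_
    change (ω ∈ W ∧ ∀ c' > c, ∃ᶠ n in atTop, h n ω < c') ↔ ω ∈ ⋂ k : ℕ, ⋂ m : ℕ, ⋃ n : ℕ,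
      ⋃ (_ : m ≤ n), {ω | h n ω < c + 1 / (k + 1)}
    simp only [hω, true_and, Set.mem_iInter, Set.mem_iUnion, Set.mem_ofPred_eq, exists_prop]
    simp only [← frequently_atTop]
    refine ⟨fun H k => H _ (by simp; positivity), fun H c' hc' => ?_⟩
    obtain ⟨k, hk⟩ := exists_nat_one_div_lt (sub_pos.2 hc')
    exact (H k).mono fun n hn => by linarith
  have hFm : NullMeasurableSet F μ := by
    refine NullMeasurableSet.congr (MeasurableSet.nullMeasurableSet ?_) hFeq.symm
    exact MeasurableSet.iInter fun k => MeasurableSet.iInter fun m => MeasurableSet.iUnion fun n =>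
      MeasurableSet.iUnion fun _ => measurableSet_lt (hm n) measurable_const
  rcases hθ.measure_eq_zero_or_one hFinv hFm with h0 | h1
  · right
    filter_upwards [hWae, measure_eq_zero_iff_ae_notMem.1 h0] with ω h1 h2
    by_contra hc
    refine h2 ⟨h1, fun c' hc' => ?_⟩
    by_contra hn
    exact hc ⟨c', hc', by simpa [Filter.Frequently] using hn⟩
  · left
    have h2 : ∀ᵐ ω ∂μ, ω ∈ F := (mem_ae_iff_prob_eq_one₀ hFm).2 h1
    exact h2.mono fun ω hω => hω.2

/-- The increments over a bounded window of the additive process generated by `g` grow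
sublinearly. -/
def HasSublinearIncrements (θ : ℝ → Ω → Ω) (g : Ω → ℝ) (ω : Ω) : Prop :=
  ∀ s : ℝ, Tendsto (fun n : ℕ => (∫ r in (n : ℝ)..(n + s), g (θ r ω)) / n) atTop (𝓝 0)

variable {g : Ω → ℝ}

theorem isFlowInvariant_hasSublinearIncrements (hθ : IsMeasurePreservingFlow μ θ)
    (hgl : ∀ ω, LocallyIntegrable (fun t => g (θ t ω)) volume) :
    IsFlowInvariant θ {ω | HasSublinearIncrements θ g ω} := by
  have key : ∀ ω u, HasSublinearIncrements θ g ω → HasSublinearIncrements θ g (θ u ω) := by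
    intro ω u h s
    have h1 := (h (u + s)).sub (h u)
    rw [sub_zero] at h1
    refine h1.congr fun n => ?_
    have hi := (hgl ω).intervalIntegrable_real
    rw [← sub_div, intervalIntegral.integral_interval_sub_left (hi _ _) (hi _ _),
      hθ.integral_orbit_comp]
    ring_nf
  intro u
  ext ω
  refine ⟨fun h => ?_, key ω u⟩
  have := key _ (-u) h
  rwa [← hθ.map_add, add_neg_cancel, hθ.map_zero] at this

/-- Integer windows are countably many, and for each the increment is an integrable function
evaluated along iterates of θ_1. A real window lies inside an integer one, and g is nonnegative. -/
theorem ae_hasSublinearIncrements [IsProbabilityMeasure μ] (hθ : IsMeasurePreservingFlow μ θ)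
    (hg0 : ∀ ω, 0 ≤ g ω) (hgm : StronglyMeasurable g) (hg : Integrable g μ)
    (hgl : ∀ ω, LocallyIntegrable (fun t => g (θ t ω)) volume) :
    ∀ᵐ ω ∂μ, HasSublinearIncrements θ g ω := by
  have h : ∀ k : ℤ, ∀ᵐ ω ∂μ,
      Tendsto (fun n : ℕ => (∫ r in (n : ℝ)..(n + k), g (θ r ω)) / n) atTop (𝓝 0) := by
    intro k
    filter_upwards [ae_tendsto_iterate_div_zero (hθ.measurePreserving 1)
      (hθ.integrable_integral_orbit hgm hg k)] with ω hω
    refine hω.congr fun n => ?_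
    rw [hθ.iterate_eq, hθ.integral_orbit_comp]
    ring_nf
  filter_upwards [ae_all_iff.2 h] with ω hω s
  obtain ⟨k, hk⟩ : ∃ k : ℤ, ∀ n : ℝ, Set.uIoc n (n + s) ⊆ Set.uIoc n (n + k) := by
    rcases le_total 0 s with hs | hs
    · refine ⟨⌈s⌉, fun n => ?_⟩
      have := Int.le_ceil s
      rw [Set.uIoc_of_le (by linarith), Set.uIoc_of_le (by linarith)]
      exact Set.Ioc_subset_Ioc_right (by linarith)
    · refine ⟨⌊s⌋, fun n => ?_⟩
      have := Int.floor_le s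
      rw [Set.uIoc_of_ge (by linarith), Set.uIoc_of_ge (by linarith)]
      exact Set.Ioc_subset_Ioc_left (by linarith)
  refine squeeze_zero_norm (fun n => ?_) ((tendsto_zero_iff_norm_tendsto_zero).1 (hω k))
  rw [norm_div, norm_div]
  refine div_le_div_of_nonneg_right ?_ (norm_nonneg _)
  exact intervalIntegral.abs_integral_mono_interval (hk n)
    (Eventually.of_forall fun _ => hg0 _) ((hgl ω).intervalIntegrable_real _ _)

/-- A subadditive process over a flow whose increments are controlled by an additive process. -/
structure IsControlledSubadditive (θ : ℝ → Ω → Ω) (g : Ω → ℝ) (f : ℝ → Ω → ℝ) : Prop where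
  measurable : ∀ t, Measurable (f t)
  map_zero : ∀ ω, f 0 ω = 0
  subadditive : ∀ s t ω, f (s + t) ω ≤ f s ω + f t (θ s ω)
  abs_sub_le : ∀ ω s t, |f t ω - f s ω| ≤ |∫ r in s..t, g (θ r ω)|
  abs_shift_sub_le : ∀ ω s t, |f t (θ s ω) - f (t + s) ω| ≤ |∫ r in (0 : ℝ)..s, g (θ r ω)|

namespace IsControlledSubadditive

variable {f : ℝ → Ω → ℝ}

/-- Compare through f(n + s, ω): the first difference is bounded independently of n, the second is a
sublinear increment. -/
theorem tendsto_shift_sub (hf : IsControlledSubadditive θ g f) {ω : Ω}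
    (hω : HasSublinearIncrements θ g ω) (s : ℝ) :
    Tendsto (fun n : ℕ => f n (θ s ω) / n - f n ω / n) atTop (𝓝 0) := by
  have h1 : Tendsto (fun n : ℕ => |∫ r in (0 : ℝ)..s, g (θ r ω)| / n) atTop (𝓝 0) :=
    tendsto_const_div_atTop_nhds_zero_nat _
  have h2 := h1.add (tendsto_zero_iff_norm_tendsto_zero.1 (hω s))
  rw [add_zero] at h2
  refine squeeze_zero_norm (fun n => ?_) h2
  rw [← sub_div, norm_div, norm_div, Real.norm_natCast, ← add_div]
  refine div_le_div_of_nonneg_right ?_ (Nat.cast_nonneg _)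
  have h3 := abs_add_le (f n (θ s ω) - f (n + s) ω) (f (n + s) ω - f n ω)
  rw [sub_add_sub_cancel] at h3
  exact h3.trans (add_le_add (hf.abs_shift_sub_le ω s n) (hf.abs_sub_le ω n (n + s)))

theorem integrable [IsFiniteMeasure μ] (hf : IsControlledSubadditive θ g f)
    (hθ : IsMeasurePreservingFlow μ θ) (hgm : StronglyMeasurable g) (hg : Integrable g μ)
    (t : ℝ) : Integrable (f t) μ := by
  refine (hθ.integrable_integral_orbit hgm hg t).mono (hf.measurable t).aestronglyMeasurable
    (Eventually.of_forall fun ω => ?_)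
  have := hf.abs_sub_le ω 0 t
  rwa [hf.map_zero, sub_zero] at this

theorem tendsto_of_tendsto_nat (hf : IsControlledSubadditive θ g f) (hg0 : ∀ ω, 0 ≤ g ω)
    (hgl : ∀ ω, LocallyIntegrable (fun t => g (θ t ω)) volume) {ω : Ω}
    (hω : HasSublinearIncrements θ g ω) {γ : ℝ}
    (h : Tendsto (fun n : ℕ => f n ω / n) atTop (𝓝 γ)) :
    Tendsto (fun t : ℝ => f t ω / t) atTop (𝓝 γ) := by
  have hfl : Tendsto (fun t : ℝ => ⌊t⌋₊) atTop atTop := tendsto_nat_floor_atTop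
  have h1 : Tendsto (fun t : ℝ => (f t ω - f ⌊t⌋₊ ω) / ⌊t⌋₊) atTop (𝓝 0) := by
    refine squeeze_zero_norm' ?_ (tendsto_zero_iff_norm_tendsto_zero.1 ((hω 1).comp hfl))
    filter_upwards [eventually_ge_atTop 0] with t ht
    simp only [Function.comp, norm_div]
    refine div_le_div_of_nonneg_right ?_ (norm_nonneg _)
    refine (hf.abs_sub_le ω _ t).trans ?_
    refine intervalIntegral.abs_integral_mono_interval ?_
      (Eventually.of_forall fun _ => hg0 _) ((hgl ω).intervalIntegrable_real _ _)
    have := Nat.floor_le ht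
    have := (Nat.lt_floor_add_one t).le
    rw [Set.uIoc_of_le (by linarith), Set.uIoc_of_le (by linarith)]
    exact Set.Ioc_subset_Ioc_right (by linarith)
  have h2 := ((h.comp hfl).add h1).mul (tendsto_nat_floor_div_atTop (R := ℝ))
  rw [add_zero, mul_one] at h2
  refine h2.congr' ?_
  filter_upwards [eventually_ge_atTop 1] with t ht
  have h3 : (0 : ℝ) < ⌊t⌋₊ := by exact_mod_cast Nat.floor_pos.2 ht
  simp only [Function.comp]
  field_simp
  ring

theorem le_birkhoffSum (hf : IsControlledSubadditive θ g f) (hθ : IsMeasurePreservingFlow μ θ)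
    (m : ℝ) (k : ℕ) (ω : Ω) :
    f (k * m) ω ≤ ∑ j ∈ Finset.range k, f m ((θ m)^[j] ω) := by
  induction k with
  | zero => simp [hf.map_zero]
  | succ k ih =>
    rw [Finset.sum_range_succ, hθ.iterate_eq]
    push_cast
    rw [add_mul, one_mul]
    exact (hf.subadditive _ _ ω).trans (add_le_add_left ih _)

/-- Here k = n / m for a suitable large n. Replacing n by k m changes f by at most an integral over
a window of length m, and c n by at most |c| m. Both are o(n), absorbed by the gap c' - c. -/
theorem exists_lt_birkhoffSum (hf : IsControlledSubadditive θ g f)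
    (hθ : IsMeasurePreservingFlow μ θ) (hg0 : ∀ ω, 0 ≤ g ω)
    (hgl : ∀ ω, LocallyIntegrable (fun t => g (θ t ω)) volume) {ω : Ω}
    (hω : HasSublinearIncrements θ g ω) {c c' : ℝ} (hc : c < c')
    (hfr : ∃ᶠ n : ℕ in atTop, c' < f n ω / n) {m : ℕ} (hm : 0 < m) :
    ∃ k : ℕ, 1 ≤ k ∧ k * (m * c) ≤ ∑ j ∈ Finset.range k, f m ((θ m)^[j] ω) := by
  have h1 := (tendsto_zero_iff_norm_tendsto_zero.1 (hω (-m))).add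
    (tendsto_const_div_atTop_nhds_zero_nat (|c| * m))
  rw [add_zero] at h1
  obtain ⟨n, hn, hn1, hnm⟩ := (hfr.and_eventually
    ((h1.eventually_lt_const (sub_pos.2 hc)).and (eventually_ge_atTop m))).exists
  have hn0 : (0 : ℝ) < n := by exact_mod_cast lt_of_lt_of_le hm hnm
  refine ⟨n / m, Nat.div_pos hnm hm, ?_⟩
  refine le_trans ?_ (hf.le_birkhoffSum hθ m (n / m) ω)
  have hle : ((n / m : ℕ) : ℝ) * m ≤ n := by exact_mod_cast Nat.div_mul_le_self n m
  have hge : (n : ℝ) ≤ ((n / m : ℕ) : ℝ) * m + m := by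
    have := (Nat.lt_div_mul_add (a := n) hm).le
    exact_mod_cast this
  have h2 : |f n ω - f ((n / m : ℕ) * m) ω| ≤ |∫ r in (n : ℝ)..(n + -m), g (θ r ω)| := by
    refine (hf.abs_sub_le ω _ _).trans (intervalIntegral.abs_integral_mono_interval ?_
      (Eventually.of_forall fun _ => hg0 _) ((hgl ω).intervalIntegrable_real _ _))
    rw [Set.uIoc_of_le hle, Set.uIoc_of_ge (by linarith)]
    exact Set.Ioc_subset_Ioc_left (by linarith)
  rw [norm_div, Real.norm_natCast, ← add_div, div_lt_iff₀ hn0, Real.norm_eq_abs] at hn1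
  rw [lt_div_iff₀ hn0] at hn
  have h3 := (abs_le.1 h2).2
  have h4 : c * (((n / m : ℕ) : ℝ) * m - n) ≤ |c| * m := by
    refine (le_abs_self _).trans ?_
    rw [abs_mul]
    refine mul_le_mul_of_nonneg_left ?_ (abs_nonneg _)
    rw [abs_le]
    constructor <;> linarith
  nlinarith

/-- A form of the subadditive ergodic theorem for controlled subadditive processes. -/
theorem exists_ae_tendsto [IsProbabilityMeasure μ] (hf : IsControlledSubadditive θ g f)
    (hθ : IsErgodicFlow μ θ) (hg0 : ∀ ω, 0 ≤ g ω) (hgm : StronglyMeasurable g) (hg : Integrable g μ)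
    (hgl : ∀ ω, LocallyIntegrable (fun t => g (θ t ω)) volume) :
    ∃ γ : ℝ, (∀ᵐ ω ∂μ, Tendsto (fun t : ℝ => f t ω / t) atTop (𝓝 γ)) ∧
      ∀ c : ℝ, (∀ n : ℕ, n * c ≤ ∫ ω, f n ω ∂μ) → c ≤ γ := by
  have hθ' := hθ.toIsMeasurePreservingFlow
  have hfi := hf.integrable hθ' hgm hg
  have hWinv := isFlowInvariant_hasSublinearIncrements hθ' hgl
  have hWae := ae_hasSublinearIncrements hθ' hg0 hgm hg hgl
  have hbd : ∀ n : ℕ, -((n : ℝ) * ∫ ω, g ω ∂μ) ≤ ∫ ω, f n ω ∂μ := by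
    intro n
    rw [← hθ'.integral_integral_orbit hgm hg (Nat.cast_nonneg n), ← integral_neg]
    refine integral_mono (hθ'.integrable_integral_orbit hgm hg n).neg (hfi n) fun ω => ?_
    have h1 := hf.abs_sub_le ω 0 n
    rw [hf.map_zero, sub_zero, abs_of_nonneg (a := ∫ r in (0 : ℝ)..n, g (θ r ω))
      (intervalIntegral.integral_nonneg (Nat.cast_nonneg n) fun _ _ => hg0 _)] at h1
    exact (abs_le.1 h1).1
  -- The shift by one avoids division by zero: the infimum runs over times n ≥ 1.
  let a : ℕ → ℝ := fun n => (∫ ω, f (n + 1 : ℕ) ω ∂μ) / (n + 1 : ℕ)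
  have hpos : ∀ n : ℕ, (0 : ℝ) < (n + 1 : ℕ) := fun n => by positivity
  have hbdd : BddBelow (Set.range a) := by
    refine ⟨-∫ ω, g ω ∂μ, ?_⟩
    rintro _ ⟨n, rfl⟩
    rw [le_div_iff₀ (hpos n)]
    linarith [hbd (n + 1)]
  have hγ : ∀ n : ℕ, n * (⨅ n, a n) ≤ ∫ ω, f n ω ∂μ := by
    intro n
    rcases Nat.eq_zero_or_pos n with rfl | hn
    · simp [hf.map_zero]
    · obtain ⟨n, rfl⟩ := Nat.exists_eq_succ_of_ne_zero hn.ne'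
      rw [mul_comm, ← le_div_iff₀ (hpos n)]
      exact ciInf_le hbdd n
  refine ⟨⨅ n, a n, ?_, fun c hc => le_ciInf fun n => ?_⟩
  swap
  · rw [le_div_iff₀ (hpos n), mul_comm]
    exact hc (n + 1)
  -- By the zero-one law the lower limit is almost surely at most c or almost surely above c. The
  -- first case would give f_n ≤ n c' for some n ≥ 1, with c' below the infimum, against the maximal
  -- inequality.
  have hlow : ∀ c < ⨅ n, a n, ∀ᵐ ω ∂μ, ∀ᶠ n : ℕ in atTop, c ≤ f n ω / n := by
    intro c hc
    rcases hθ.ae_frequently_lt_or_ae_eventually_le hWinv hWae (h := fun n ω => f n ω / n)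
      (fun n => (hf.measurable n).div_const _) (fun ω hω s => hf.tendsto_shift_sub hω s) c
      with h | h
    · exfalso
      obtain ⟨c', h1, h2⟩ := exists_between hc
      refine absurd ?_ (not_le.2 h2)
      refine le_of_subadditive_of_ae_exists_le (hθ'.measurePreserving 1)
        (f := fun n => f n) (fun ω => by simp [hf.map_zero]) (fun m n ω => ?_)
        (fun n => hf.measurable n) (fun n => hfi n) hγ ?_
      · rw [hθ'.iterate_eq, mul_one, Nat.cast_add]
        exact hf.subadditive _ _ _
      · filter_upwards [h] with ω hω
        obtain ⟨n, hn, hn1⟩ := ((hω c' h1).and_eventually (eventually_ge_atTop 1)).exists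
        have hn0 : (0 : ℝ) < n := by exact_mod_cast hn1
        exact ⟨n, hn1, by rw [mul_comm]; exact ((div_lt_iff₀ hn0).1 hn).le⟩
    · filter_upwards [h] with ω ⟨c', h1, h2⟩
      exact h2.mono fun n hn => h1.le.trans hn
  -- If the upper limit were almost surely at least c, then for m + 1 with ∫ f_{m+1} < (m + 1) c₂
  -- the Birkhoff sums of f_{m+1} would almost surely reach k (m + 1) c₂ for some k ≥ 1. The maximal
  -- inequality for their negatives gives the opposite bound on ∫ f_{m+1}.
  have hup : ∀ c > ⨅ n, a n, ∀ᵐ ω ∂μ, ∀ᶠ n : ℕ in atTop, f n ω / n ≤ c := by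
    intro c hc
    rcases hθ.ae_frequently_lt_or_ae_eventually_le hWinv hWae (h := fun n ω => -(f n ω / n))
      (fun n => ((hf.measurable n).div_const _).neg) (fun ω hω s => by
        have := (hf.tendsto_shift_sub hω s).neg
        rw [neg_zero] at this
        exact this.congr fun n => by ring) (-c) with h | h
    · exfalso
      obtain ⟨c₁, h1, h2⟩ := exists_between hc
      obtain ⟨c₂, h3, h4⟩ := exists_between h1
      obtain ⟨m, hm⟩ := exists_lt_of_ciInf_lt h3
      rw [div_lt_iff₀ (hpos m)] at hm
      have hT := hθ'.measurePreserving (m + 1 : ℕ)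
      have hi : ∀ j, Integrable (fun ω => f (m + 1 : ℕ) ((θ (m + 1 : ℕ))^[j] ω)) μ := fun j =>
        ((hT.iterate j).integrable_comp (hfi _).1).2 (hfi _)
      have key := le_of_subadditive_of_ae_exists_le hT
        (f := fun k ω => -∑ j ∈ Finset.range k, f (m + 1 : ℕ) ((θ (m + 1 : ℕ))^[j] ω))
        (c := -((m + 1 : ℕ) * c₂)) (γ := -∫ ω, f (m + 1 : ℕ) ω ∂μ)
        (fun ω => by simp) (fun k l ω => ?_)
        (fun k => (Finset.measurable_sum _ fun j _ =>
          (hf.measurable _).comp (hT.measurable.iterate j)).neg)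
        (fun k => (integrable_finsetSum _ fun j _ => hi j).neg) (fun k => ?_) ?_
      · linarith
      · rw [Finset.sum_range_add, neg_add]
        simp only [← Function.iterate_add_apply, add_comm, le_refl]
      · rw [integral_neg, integral_finsetSum _ fun j _ => hi j]
        simp only [(hT.iterate _).integral_comp_real (hfi _).1]
        simp
      · filter_upwards [h, hWae] with ω hω hWω
        have hfr : ∃ᶠ n : ℕ in atTop, c₁ < f n ω / n :=
          (hω (-c₁) (by linarith)).mono fun n hn => by linarith
        obtain ⟨k, hk1, hk⟩ := hf.exists_lt_birkhoffSum hθ' hg0 hgl hWω h4 hfr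
          (Nat.succ_pos m)
        exact ⟨k, hk1, by rw [mul_neg]; exact neg_le_neg hk⟩
    · filter_upwards [h] with ω ⟨c', h1, h2⟩
      exact h2.mono fun n hn => by linarith
  have hlow' : ∀ᵐ ω ∂μ, ∀ k : ℕ, ∀ᶠ n : ℕ in atTop, (⨅ n, a n) - 1 / (k + 1) ≤ f n ω / n :=
    ae_all_iff.2 fun k => hlow _ (by
      have : (0 : ℝ) < 1 / (k + 1) := by positivity
      linarith)
  have hup' : ∀ᵐ ω ∂μ, ∀ k : ℕ, ∀ᶠ n : ℕ in atTop, f n ω / n ≤ (⨅ n, a n) + 1 / (k + 1) :=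
    ae_all_iff.2 fun k => hup _ (by
      have : (0 : ℝ) < 1 / (k + 1) := by positivity
      linarith)
  filter_upwards [hlow', hup', hWae] with ω h1 h2 h3
  refine hf.tendsto_of_tendsto_nat hg0 hgl h3 ?_
  rw [Metric.tendsto_nhds]
  intro ε hε
  obtain ⟨k, hk⟩ := exists_nat_one_div_lt hε
  filter_upwards [h1 k, h2 k] with n h4 h5
  rw [Real.dist_eq, abs_lt]
  constructor <;> linarith

end IsControlledSubadditive

end SubadditiveFlow

/-! ### Minimal row sums and passage from entries to operators -/

section RowSums

theorem abs_iInf_sum_le {N : ℕ} [NeZero N] (M : Matrix (Fin N) (Fin N) ℝ) :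
    |⨅ i, ∑ j, M i j| ≤ ∑ i, ∑ j, |M i j| := by
  obtain ⟨i, hi⟩ := exists_eq_ciInf_of_finite (f := fun i => ∑ j, M i j)
  rw [← hi]
  exact (Finset.abs_sum_le_sum_abs _ _).trans
    (Finset.single_le_sum (f := fun i => ∑ j, |M i j|)
      (fun i _ => Finset.sum_nonneg fun j _ => abs_nonneg _) (Finset.mem_univ i))

theorem integrable_iInf_sum {N : ℕ} [NeZero N] {α : Type*} [MeasurableSpace α] {ν : Measure α}
    {M : α → Matrix (Fin N) (Fin N) ℝ} (hM : ∀ i j, Integrable (fun x => M x i j) ν) :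
    Integrable (fun x => ⨅ i, ∑ j, M x i j) ν := by
  refine Integrable.mono' (g := fun x => ∑ i, ∑ j, |M x i j|)
    (integrable_finsetSum _ fun i _ => integrable_finsetSum _ fun j _ => (hM i j).abs)
    ?_ (Eventually.of_forall fun x => abs_iInf_sum_le _)
  exact (AEMeasurable.iInf fun i =>
    Finset.aemeasurable_fun_sum _ fun j _ => (hM i j).1.aemeasurable).aestronglyMeasurable

theorem locallyIntegrable_iInf_sum {N : ℕ} [NeZero N] {M : ℝ → Matrix (Fin N) (Fin N) ℝ}
    (hM : ∀ i j, LocallyIntegrable (fun t => M t i j) volume) :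
    LocallyIntegrable (fun t => ⨅ i, ∑ j, M t i j) volume :=
  locallyIntegrable_iff.2 fun _ hK =>
    integrable_iInf_sum fun i j => (hM i j).integrableOn_isCompact hK

theorem toEuclideanCLM_eq_sum {N : ℕ} (M : Matrix (Fin N) (Fin N) ℝ) :
    Matrix.toEuclideanCLM (𝕜 := ℝ) M
      = ∑ i, ∑ j, M i j • Matrix.toEuclideanCLM (𝕜 := ℝ) (Matrix.single i j (1 : ℝ)) := by
  conv_lhs => rw [Matrix.matrix_eq_sum_single M]
  simp only [map_sum, ← map_smul, Matrix.smul_single, smul_eq_mul, mul_one]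

theorem integrable_sum_smul {N : ℕ} {α F : Type*} [MeasurableSpace α] {ν : Measure α}
    [NormedAddCommGroup F] [NormedSpace ℝ F] {M : α → Matrix (Fin N) (Fin N) ℝ}
    (hM : ∀ i j, Integrable (fun x => M x i j) ν) (e : Fin N → Fin N → F) :
    Integrable (fun x => ∑ i, ∑ j, M x i j • e i j) ν :=
  integrable_finsetSum _ fun i _ => integrable_finsetSum _ fun j _ => (hM i j).smul_const _

theorem integrable_toEuclideanCLM {N : ℕ} {α : Type*} [MeasurableSpace α] {ν : Measure α}
    {M : α → Matrix (Fin N) (Fin N) ℝ} (hM : ∀ i j, Integrable (fun x => M x i j) ν) :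
    Integrable (fun x => Matrix.toEuclideanCLM (𝕜 := ℝ) (M x)) ν := by
  simp_rw [toEuclideanCLM_eq_sum (M _)]
  exact integrable_sum_smul hM fun i j =>
    Matrix.toEuclideanCLM (𝕜 := ℝ) (Matrix.single i j (1 : ℝ))

theorem locallyIntegrable_toEuclideanCLM {N : ℕ} {M : ℝ → Matrix (Fin N) (Fin N) ℝ}
    (hM : ∀ i j, LocallyIntegrable (fun t => M t i j) volume) :
    LocallyIntegrable (fun t => Matrix.toEuclideanCLM (𝕜 := ℝ) (M t)) volume :=
  locallyIntegrable_iff.2 fun _ hK =>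
    integrable_toEuclideanCLM fun i j => (hM i j).integrableOn_isCompact hK

theorem stronglyMeasurable_toEuclideanCLM {N : ℕ} {α : Type*} [MeasurableSpace α]
    {M : α → Matrix (Fin N) (Fin N) ℝ} (hM : ∀ i j, StronglyMeasurable (fun x => M x i j)) :
    StronglyMeasurable (fun x => Matrix.toEuclideanCLM (𝕜 := ℝ) (M x)) := by
  simp_rw [toEuclideanCLM_eq_sum (M _)]
  exact Finset.stronglyMeasurable_fun_sum _ fun i _ => Finset.stronglyMeasurable_fun_sum _
    fun j _ => (hM i j).smul_const _

end RowSums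

/-! ### Comparison with the scalar equation -/

section Positivity

theorem picardTerm_real_nonneg {p : ℝ → ℝ} (hp : ∀ t, 0 ≤ p t) (n : ℕ) {t : ℝ} (ht : 0 ≤ t) :
    0 ≤ picardTerm p n t := by
  induction n generalizing t with
  | zero => simp [picardTerm]
  | succ n ih => exact intervalIntegral.integral_nonneg ht fun s hs => mul_nonneg (hp s) (ih hs.1)

variable {N : ℕ}

theorem toEuclideanCLM_apply_apply (M : Matrix (Fin N) (Fin N) ℝ) (v : EuclideanSpace ℝ (Fin N))
    (i : Fin N) : Matrix.toEuclideanCLM (𝕜 := ℝ) M v i = ∑ j, M i j * v j := by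
  rw [Matrix.ofLp_toEuclideanCLM]
  rfl

/-- For a nonnegative coefficient matrix whose row sums are bounded below by `p`, the Picard
iterates dominate those of the scalar equation with coefficient `p`. -/
theorem picardTerm_le_apply_one {P : ℝ → Matrix (Fin N) (Fin N) ℝ} {p : ℝ → ℝ}
    (hP : ∀ i j, LocallyIntegrable (fun t => P t i j) volume)
    (hp : LocallyIntegrable p volume) (hP0 : ∀ t i j, 0 ≤ P t i j) (hp0 : ∀ t, 0 ≤ p t)
    (hrow : ∀ t i, p t ≤ ∑ j, P t i j) (n : ℕ) {t : ℝ} (ht : 0 ≤ t) (i : Fin N) :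
    picardTerm p n t ≤
      picardTerm (fun t => Matrix.toEuclideanCLM (𝕜 := ℝ) (P t)) n t (WithLp.toLp 2 1) i := by
  have hL := locallyIntegrable_toEuclideanCLM hP
  induction n generalizing t i with
  | zero => simp [picardTerm]
  | succ n ih =>
    let φ : (EuclideanSpace ℝ (Fin N) →L[ℝ] EuclideanSpace ℝ (Fin N)) →L[ℝ] ℝ :=
      (EuclideanSpace.proj i).comp (ContinuousLinearMap.apply ℝ _ (WithLp.toLp 2 1))
    have hi := (hL.mul_continuous_real (continuous_picardTerm hL n)).intervalIntegrable_real 0 t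
    have h1 := φ.intervalIntegral_comp_comm hi
    change _ ≤ φ (picardTerm _ (n + 1) t)
    simp only [picardTerm]
    rw [← h1]
    refine intervalIntegral.integral_mono_on ht
      ((hp.mul_continuous_real (continuous_picardTerm hp n)).intervalIntegrable_real 0 t)
      ⟨φ.integrable_comp hi.1, φ.integrable_comp hi.2⟩ fun s hs => ?_
    change _ ≤ Matrix.toEuclideanCLM (𝕜 := ℝ) (P s) (picardTerm
      (fun t => Matrix.toEuclideanCLM (𝕜 := ℝ) (P t)) n s (WithLp.toLp 2 1)) i
    rw [toEuclideanCLM_apply_apply]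
    refine (mul_le_mul_of_nonneg_right (hrow s i) (picardTerm_real_nonneg hp0 n hs.1)).trans ?_
    rw [Finset.sum_mul]
    exact Finset.sum_le_sum fun j _ => mul_le_mul_of_nonneg_left (ih hs.1 j) (hP0 s i j)

/-- The solution operator of a system of ML-matrices grows at least as fast as the solution of the
scalar equation whose coefficient is the minimal row sum. -/
theorem exp_integral_iInf_sum_le_norm [NeZero N] {M : ℝ → Matrix (Fin N) (Fin N) ℝ}
    (hM : ∀ i j, LocallyIntegrable (fun t => M t i j) volume) (hML : ∀ t, IsMLMatrix (M t))
    {t : ℝ} (ht : 0 ≤ t) :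
    Real.exp (∫ s in (0 : ℝ)..t, ⨅ i, ∑ j, M s i j)
      ≤ ‖picardSeries (fun t => Matrix.toEuclideanCLM (𝕜 := ℝ) (M t)) t‖ := by
  have hL := locallyIntegrable_toEuclideanCLM hM
  have hm := locallyIntegrable_iInf_sum hM
  -- Large enough to make every diagonal entry of M + c nonnegative; the factor exp ∫ c appears on
  -- both sides of the comparison and cancels.
  let c : ℝ → ℝ := fun t => ∑ k, |M t k k|
  have hc : LocallyIntegrable c volume := locallyIntegrable_finsetSum _ fun k _ =>
    (hM k k).norm_real
  let P : ℝ → Matrix (Fin N) (Fin N) ℝ := fun t => M t + c t • (1 : Matrix (Fin N) (Fin N) ℝ)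
  let p : ℝ → ℝ := fun t => (⨅ i, ∑ j, M t i j) + c t
  have hPapp : ∀ t i j, P t i j = M t i j + c t * (1 : Matrix (Fin N) (Fin N) ℝ) i j :=
    fun t i j => rfl
  have hp : LocallyIntegrable p volume := hm.add hc
  have hP : ∀ i j, LocallyIntegrable (fun t => P t i j) volume := fun i j =>
    (hM i j).add (hc.mul_continuous_real continuous_const)
  have hP0 : ∀ t i j, 0 ≤ P t i j := by
    intro t i j
    rw [hPapp]
    rcases eq_or_ne i j with rfl | hij
    · rw [Matrix.one_apply_eq, mul_one]
      have h1 := Finset.single_le_sum (f := fun k => |M t k k|) (fun k _ => abs_nonneg _)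
        (Finset.mem_univ i)
      have h2 := neg_abs_le (M t i i)
      simp only [c]
      linarith
    · rw [Matrix.one_apply_ne hij, mul_zero, add_zero]
      exact hML t i j hij
  have hsum : ∀ t i, ∑ j, P t i j = (∑ j, M t i j) + c t := by
    intro t i
    simp only [hPapp, Finset.sum_add_distrib, ← Finset.mul_sum]
    simp [Matrix.one_apply]
  have hrow : ∀ t i, p t ≤ ∑ j, P t i j := by
    intro t i
    rw [hsum]
    exact add_le_add_left (ciInf_le (Set.finite_range _).bddBelow i) _
  have hp0 : ∀ t, 0 ≤ p t := by
    intro t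
    obtain ⟨i, hi⟩ := exists_eq_ciInf_of_finite (f := fun i => ∑ j, M t i j)
    simp only [p, ← hi]
    rw [← hsum]
    exact Finset.sum_nonneg fun j _ => hP0 t i j
  have hLP := locallyIntegrable_toEuclideanCLM hP
  have hPL : (fun t => Matrix.toEuclideanCLM (𝕜 := ℝ) (P t))
      = fun t => Matrix.toEuclideanCLM (𝕜 := ℝ) (M t) + c t • 1 := by
    funext t
    simp only [P, map_add, map_smul, map_one]
  set U := picardSeries (fun t => Matrix.toEuclideanCLM (𝕜 := ℝ) (M t)) t with hU
  have hcoord : ∀ i, Real.exp (∫ s in (0 : ℝ)..t, ⨅ i, ∑ j, M s i j) ≤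
      U (WithLp.toLp 2 1) i := by
    intro i
    have h1 := (hasSum_picardTerm hLP t).mapL
      ((EuclideanSpace.proj (𝕜 := ℝ) i).comp (ContinuousLinearMap.apply ℝ _ (WithLp.toLp 2 1)))
    have h2 := hasSum_le (fun n => picardTerm_le_apply_one hP hp hP0 hp0 hrow n ht i)
      (hasSum_picardTerm hp t) h1
    rw [picardSeries_real hp, hPL, picardSeries_add_smul_one hL hc] at h2
    simp only [p] at h2
    rw [intervalIntegral.integral_add (hm.intervalIntegrable_real _ _)
      (hc.intervalIntegrable_real _ _), add_comm, Real.exp_add] at h2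
    exact le_of_mul_le_mul_left h2 (Real.exp_pos _)
  have hone : 0 < ‖(WithLp.toLp 2 1 : EuclideanSpace ℝ (Fin N))‖ := by
    rw [norm_pos_iff]
    intro h
    simpa using congrArg (fun v : EuclideanSpace ℝ (Fin N) => v 0) h
  refine le_of_mul_le_mul_right ?_ hone
  refine le_trans ?_ (U.le_opNorm _)
  rw [← Real.norm_of_nonneg (Real.exp_pos _).le, ← norm_smul, EuclideanSpace.norm_eq,
    EuclideanSpace.norm_eq]
  refine Real.sqrt_le_sqrt (Finset.sum_le_sum fun i _ => pow_le_pow_left₀ (norm_nonneg _) ?_ 2)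
  refine le_trans ?_ (le_abs_self _)
  rw [Real.norm_of_nonneg (by simp; positivity)]
  simpa using hcoord i

end Positivity

/-! ### The top Lyapunov exponent -/

section TopExponent

variable {Ω : Type*} [MeasurableSpace Ω] {μ : Measure Ω} {θ : ℝ → Ω → Ω}

/-- The cocycle identity gives subadditivity, and with times t and -t also a left inverse, so the
norm never vanishes. All increments are controlled by the a priori bound exp |∫ ‖B‖|. -/
theorem isControlledSubadditive_log_norm {R : Type*} [NormedRing R] [NormedAlgebra ℝ R]
    [NormOneClass R] [CompleteSpace R] (hθ : IsMeasurePreservingFlow μ θ) {B : Ω → R}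
    (hBm : StronglyMeasurable B) (hB : ∀ ω, LocallyIntegrable (fun t => B (θ t ω)) volume) :
    IsControlledSubadditive θ (fun ω => ‖B ω‖)
      (fun t ω => Real.log ‖picardSeries (fun r => B (θ r ω)) t‖) := by
  have : Nontrivial R := NormOneClass.nontrivial
  have hcoc : ∀ ω s t, picardSeries (fun r => B (θ r ω)) (s + t)
      = picardSeries (fun r => B (θ r (θ s ω))) t * picardSeries (fun r => B (θ r ω)) s := by
    intro ω s t
    rw [add_comm, picardSeries_add (hB ω), hθ.orbit_add]
  have hpos : ∀ ω t, 0 < ‖picardSeries (fun r => B (θ r ω)) t‖ := by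
    intro ω t
    have h := hcoc ω t (-t)
    rw [add_neg_cancel, picardSeries_zero (hB ω)] at h
    refine norm_pos_iff.2 fun h0 => ?_
    rw [h0, mul_zero] at h
    exact one_ne_zero h
  have hlog : ∀ ω s t, Real.log ‖picardSeries (fun r => B (θ r (θ s ω))) t‖
      ≤ |∫ r in s..(t + s), ‖B (θ r ω)‖| := by
    intro ω s t
    refine (Real.log_le_log (hpos _ _) (norm_picardSeries_le (hB _) _)).trans_eq ?_
    rw [Real.log_exp, hθ.integral_orbit_comp (fun ω => ‖B ω‖), zero_add]
  have hmul : ∀ ω s t, Real.log ‖picardSeries (fun r => B (θ r ω)) (s + t)‖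
      ≤ Real.log ‖picardSeries (fun r => B (θ r ω)) s‖
        + Real.log ‖picardSeries (fun r => B (θ r (θ s ω))) t‖ := by
    intro ω s t
    rw [← Real.log_mul (hpos _ _).ne' (hpos _ _).ne']
    refine Real.log_le_log (hpos _ _) ?_
    rw [hcoc, mul_comm ‖_‖]
    exact norm_mul_le _ _
  have hinc : ∀ ω s t, Real.log ‖picardSeries (fun r => B (θ r ω)) t‖
      - Real.log ‖picardSeries (fun r => B (θ r ω)) s‖ ≤ |∫ r in s..t, ‖B (θ r ω)‖| := by
    intro ω s t
    have h1 := hmul ω s (t - s)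
    have h2 := hlog ω s (t - s)
    rw [add_sub_cancel] at h1
    rw [sub_add_cancel] at h2
    linarith
  refine ⟨fun t => ?_, fun ω => ?_, fun s t ω => hmul ω s t, fun ω s t => ?_, fun ω s t => ?_⟩
  · refine Real.measurable_log.comp (StronglyMeasurable.measurable ?_)
    exact (stronglyMeasurable_picardSeries hB
      (hBm.comp_measurable hθ.measurable_orbit) t).norm
  · rw [picardSeries_zero (hB ω), norm_one, Real.log_one]
  · refine abs_sub_le_iff.2 ⟨hinc ω s t, ?_⟩
    rw [intervalIntegral.integral_symm, abs_neg]
    exact hinc ω t s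
  · refine abs_sub_le_iff.2 ⟨?_, ?_⟩
    -- From θ_s ω, go back to ω by time -s, then run for time t + s.
    · have h1 := hmul (θ s ω) (-s) (t + s)
      have h2 := hlog ω s (-s)
      rw [neg_add_cancel, intervalIntegral.integral_symm, abs_neg] at h2
      rw [← hθ.map_add, add_neg_cancel, hθ.map_zero, neg_add_eq_sub, add_sub_cancel_right] at h1
      linarith
    · have h1 := hmul ω s t
      have h2 := hlog ω 0 s
      rw [hθ.map_zero, add_zero] at h2
      rw [add_comm s t] at h1
      linarith

/-- The top Lyapunov exponent is unique. -/
theorem IsTopLyapunovExponent.unique [IsProbabilityMeasure μ] {N : ℕ}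
    {A : Ω → Matrix (Fin N) (Fin N) ℝ} {l₁ l₂ : ℝ} (h₁ : IsTopLyapunovExponent μ θ A l₁)
    (h₂ : IsTopLyapunovExponent μ θ A l₂) : l₁ = l₂ := by
  obtain ⟨F₁, hm₁, -, hF₁, h₁⟩ := h₁
  obtain ⟨F₂, hm₂, -, hF₂, h₂⟩ := h₂
  have h1 : ∀ᵐ ω ∂μ, ω ∈ F₁ := (mem_ae_iff_prob_eq_one hm₁).2 hF₁
  have h2 : ∀ᵐ ω ∂μ, ω ∈ F₂ := (mem_ae_iff_prob_eq_one hm₂).2 hF₂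
  obtain ⟨ω, hω1, hω2⟩ := (h1.and h2).exists
  exact tendsto_nhds_unique (h₁ ω hω1).2 (h₂ ω hω2).2

theorem exists_isTopLyapunovExponent [IsProbabilityMeasure μ] (hθ : IsErgodicFlow μ θ) {N : ℕ}
    [NeZero N] {A : Ω → Matrix (Fin N) (Fin N) ℝ} (hA0 : ∀ i j, Integrable (fun ω => A ω i j) μ)
    (hA1 : ∀ ω, IsMLMatrix (A ω)) :
    ∃ lam, IsTopLyapunovExponent μ θ A lam ∧ ∫ ω, (⨅ i, ∑ j, A ω i j) ∂μ ≤ lam := by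
  have hθ' := hθ.toIsMeasurePreservingFlow
  obtain ⟨A', hm, hML, hloc, hae⟩ := exists_regular_version hθ' hA0 hA1
  have hint : ∀ i j, Integrable (fun ω => A' ω i j) μ := fun i j =>
    (hA0 i j).congr (hae.mono fun ω hω => congrFun (congrFun hω i) j)
  let B : Ω → EuclideanSpace ℝ (Fin N) →L[ℝ] EuclideanSpace ℝ (Fin N) := fun ω =>
    Matrix.toEuclideanCLM (𝕜 := ℝ) (A' ω)
  have hBm : StronglyMeasurable B := stronglyMeasurable_toEuclideanCLM hm
  have hBi : Integrable B μ := integrable_toEuclideanCLM hint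
  have hBl : ∀ ω, LocallyIntegrable (fun t => B (θ t ω)) volume := fun ω =>
    locallyIntegrable_toEuclideanCLM (M := fun t => A' (θ t ω)) (hloc ω)
  have hf := isControlledSubadditive_log_norm hθ' hBm hBl
  have hg0 : ∀ ω, 0 ≤ ‖B ω‖ := fun ω => norm_nonneg _
  have hgl : ∀ ω, LocallyIntegrable (fun t => ‖B (θ t ω)‖) volume := fun ω => (hBl ω).norm_real
  obtain ⟨γ, hγ, hγ'⟩ := hf.exists_ae_tendsto hθ hg0 hBm.norm hBi.norm hgl
  refine ⟨γ, ?_, hγ' _ fun n => ?_⟩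
  · have hWinv := isFlowInvariant_hasSublinearIncrements (g := fun ω => ‖B ω‖) hθ' hgl
    have hWae := ae_hasSublinearIncrements hθ' hg0 hBm.norm hBi.norm hgl
    obtain ⟨F, hFm, hFi, hF1, hF⟩ := hθ'.exists_invariant_ae_orbit (hae.and (hWae.and hγ))
    refine ⟨F, hFm, hFi, hF1, fun ω hω => ?_⟩
    have hA' : ∀ᵐ t, A (θ t ω) = A' (θ t ω) := (hF ω hω).mono fun t ht => ht.1
    refine ⟨existsUnique_isSolutionOperator (hBl ω) hA', ?_⟩
    rw [linearRDS, solutionOperator_eq_picardSeries (hBl ω) hA']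
    -- One good point θ_s ω on the orbit suffices: sublinear increments are an invariant property,
    -- and the integer-time limit is unchanged by the shift.
    obtain ⟨s, -, hWs, hs⟩ := (hF ω hω).exists
    have hWω : HasSublinearIncrements θ (fun ω => ‖B ω‖) ω := (hWinv.mem_iff s ω).1 hWs
    refine hf.tendsto_of_tendsto_nat hg0 hgl hWω ?_
    have h1 := (hs.comp tendsto_natCast_atTop_atTop).sub (hf.tendsto_shift_sub hWω s)
    rw [sub_zero] at h1
    exact h1.congr fun n => by simp only [Function.comp, sub_sub_cancel]
  · have hmin : StronglyMeasurable fun ω => ⨅ i, ∑ j, A' ω i j :=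
      (Measurable.iInf fun i => Finset.measurable_fun_sum _ fun j _ =>
        (hm i j).measurable).stronglyMeasurable
    have hmini := integrable_iInf_sum hint
    have hcongr : ∫ ω, (⨅ i, ∑ j, A ω i j) ∂μ = ∫ ω, (⨅ i, ∑ j, A' ω i j) ∂μ :=
      integral_congr_ae (hae.mono fun ω hω => by simp only [hω])
    -- By stationarity, n times the mean minimal row sum is the expectation of its integral over [0,
    -- n], which is at most ln ‖U(n)‖ pointwise.
    rw [hcongr, ← hθ'.integral_integral_orbit hmin hmini (Nat.cast_nonneg n)]
    refine integral_mono (hθ'.integrable_integral_orbit hmin hmini n)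
      (hf.integrable hθ' hBm.norm hBi.norm n) fun ω => ?_
    rw [← Real.log_exp (∫ s in (0 : ℝ)..n, ⨅ i, ∑ j, A' (θ s ω) i j)]
    exact Real.log_le_log (Real.exp_pos _) (exp_integral_iInf_sum_le_norm
      (M := fun t => A' (θ t ω)) (hloc ω) (fun t => hML _) (Nat.cast_nonneg n))

end TopExponent

theorem mainTheorem2 {Ω : Type*} [MeasurableSpace Ω] (μ : Measure Ω) [IsProbabilityMeasure μ]
    (θ : ℝ → Ω → Ω) (hθ : IsErgodicFlow μ θ) {N : ℕ} (hN : 0 < N)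
    (A : Ω → Matrix (Fin N) (Fin N) ℝ)
    (hA0 : ∀ i j, Integrable (fun ω => A ω i j) μ)
    (hA1 : ∀ ω, IsMLMatrix (A ω)) :
    (∃! lam : ℝ, IsTopLyapunovExponent μ θ A lam) ∧
      Integrable (fun ω => ⨅ i, ∑ j, A ω i j) μ ∧
      ∀ lam : ℝ, IsTopLyapunovExponent μ θ A lam → ∫ ω, (⨅ i, ∑ j, A ω i j) ∂μ ≤ lam := by
  have : NeZero N := ⟨hN.ne'⟩
  obtain ⟨lam, hlam, hle⟩ := exists_isTopLyapunovExponent hθ hA0 hA1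
  refine ⟨⟨lam, hlam, fun l hl => hl.unique hlam⟩, integrable_iInf_sum hA0, fun l hl => ?_⟩
  rw [hl.unique hlam]
  exact hle
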